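/- Let $X$ be (the polyhedron of) a finite simplicial complex. Identify $\mathrm{M}_n(\mathrm{C}(X))$ with the C*-algebra of continuous functions $X \to \mathrm{M}_n(\mathbb{C})$, with pointwise operations and order and the supremum of the operator norms. For positive $a \in \mathrm{M}_n(\mathrm{C}(X))$ let $n_1 < \cdots < n_k$ be the values taken by the rank function $x \mapsto \mathrm{rank}(a(x))$, and let $F_{i,a} = \{x \in X : \mathrm{rank}(a(x)) = n_i\}$. The element $a$ is called well supported if for each $1 \le i \le k$ there is a projection $p_i \in \mathrm{M}_n(\mathrm{C}(\overline{F_{i,a}}))$ such that \[ \lim_{r \to \infty} a(x)^{1/r} = p_i(x) \quad \text{for all } x \in F_{i,a}, \] and $p_i(x) \le p_j(x)$ whenever $x \in \overline{F_{i,a}} \cap \overline{F_{j,a}}$ and $i \le j$. Theorem. Let $X$ be a finite simplicial complex, let $a \in \mathrm{M}_n(\mathrm{C}(X))$ be positive and let $\varepsilon > 0$. Then there is a well supported positive element $f \in \mathrm{M}_n(\mathrm{C}(X))$ such that $f \le a$, $\|f - a\| < \varepsilon$, the rank functions of $f$ and of $a$ take the same set of values $n_1 < \cdots < n_k$, and,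 for some refinement of the simplicial structure of $X$ (a finite simplicial complex with the same polyhedron, each simplex of which is contained in a simplex of the original one), every set $\overline{F_{i,f}}$, $1 \le i \le k$, is the polyhedron of a subcomplex of the refined complex. -/

import Mathlib

open Set Filter Topology
open scoped Matrix.Norms.L2Operator MatrixOrder

/-- `M_n(C(X))`, identified in the standard way with the continuous functions from `X` to the
C⋆-algebra `M_n(ℂ)` (operator norm for the Euclidean norm on `ℂⁿ`, Loewner order).
The algebraic operations, the adjoint and the order are pointwise; for compact `X` the norm is
the supremum norm. -/
abbrev MatFun (n : ℕ) (X : Type*) [TopologicalSpace X] : Type _ :=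
  C(X, Matrix (Fin n) (Fin n) ℂ)

namespace MatFun

variable {n : ℕ} {X : Type*} [TopologicalSpace X]

/-- The set of values taken by the rank function `x ↦ rank (a x)`. -/
def rankValues (a : MatFun n X) : Set ℕ :=
  Set.range fun x => (a x).rank

/-- The set `F_m` of points at which `a` has rank exactly `m`. -/
def rankSet (a : MatFun n X) (m : ℕ) : Set X :=
  {x | (a x).rank = m}

/-- `a` is well supported: for each rank value `m` of `a` there is a projection `p m` in
`M_n(C(closure F_m))` which on `F_m` is the support projection `lim_{r → ∞} a(x)^{1/r}` of `a(x)`,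
and `p i ≤ p j` on `closure F_i ∩ closure F_j` for all rank values `i ≤ j`. The power `a(x)^{1/r}`
is the one of the continuous functional calculus. -/
def IsWellSupported (a : MatFun n X) : Prop :=
  ∃ p : ∀ m : a.rankValues, MatFun n (closure (a.rankSet m)),
    (∀ m, IsStarProjection (p m)) ∧
    (∀ m : a.rankValues, ∀ x, ∀ hx : x ∈ a.rankSet m,
      Tendsto (fun r : ℝ => a x ^ (1 / r)) atTop (𝓝 (p m ⟨x, subset_closure hx⟩))) ∧
    (∀ i j : a.rankValues, i ≤ j → ∀ x, ∀ hi : x ∈ closure (a.rankSet i), ∀ hj : x ∈ closure (a.rankSet j),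
      p i ⟨x, hi⟩ ≤ p j ⟨x, hj⟩)

end MatFun

namespace Geometry.SimplicialComplex

variable {E : Type*} [NormedAddCommGroup E] [NormedSpace ℝ E]

/-- The polyhedron of a finite simplicial complex is compact. -/
instance compactSpace_space (K : SimplicialComplex ℝ E) [Finite K.faces] :
    CompactSpace K.space :=
  isCompact_iff_compactSpace.mp <|
    (Set.toFinite K.faces).isCompact_biUnion fun s _ =>
      s.finite_toSet.isCompact_convexHull ℝ

/-- `K'` is a refinement (subdivision) of the finite complex `K`: a finite simplicial complex with
the same polyhedron, each simplex of which is contained in a simplex of `K`. -/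
def IsRefinement (K' K : SimplicialComplex ℝ E) : Prop :=
  K'.faces.Finite ∧ K'.space = K.space ∧
    ∀ t ∈ K'.faces, ∃ s ∈ K.faces,
      convexHull ℝ (t : Set E) ⊆ convexHull ℝ (s : Set E)

/-- The subset `Y` of `E` is (the polyhedron of) a subcomplex of `K`. -/
def IsSubcomplexSpace (K : SimplicialComplex ℝ E) (Y : Set E) : Prop :=
  ∃ L : SimplicialComplex ℝ E, L ≤ K ∧ L.space = Y

end Geometry.SimplicialComplex

/-! Small eigenvalues of `a` are cut off, with a cutoff level depending on the rank stratum. For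
each rank value m there is a threshold δ_m > 0, decreasing in m, with 2δ_0 < ε. Compactness gives
thresholds with the following property (`exists_thresholds`): if for every rank value j < m more
than j eigenvalues of a(x) exceed δ_j/2, then at least m eigenvalues exceed 2δ_m.

For each m, two open sets cover X: at most m eigenvalues are ≥ δ_m, or more than m are > δ_m/2. By
the Lebesgue number lemma, on a fine refinement every simplex lies in one of the two. Let V_m be the
union of the simplices of the first kind; the m-th stratum is V_m minus all V_j with j < m. Its
closure is the union of the simplices in V_m of the first kind for m but for no smaller j
(`closure_polyhedron_diff`), hence a subcomplex. On the whole closure at most m eigenvalues are ≥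
δ_m and at least m are > 2δ_m, so the spectrum has a gap at [δ_m, 2δ_m].

Put f(x) = h_x(a(x)), where h_x(t) is t times a cutoff for each m; that cutoff kills [0, δ_m]
exactly when x ∈ V_m and fades out with the distance to V_m. On the m-th stratum exactly the m
eigenvalues above the gap survive. The support projection there is `ramp (δ m)` of a(x), which is
continuous in x, remains a projection on the closure because of the gap, and increases with m
because δ_m decreases (`exists_isWellSupported_of_stratification`).

Fine refinements come from bisecting long edges, measured in an auxiliary Euclidean norm. -/

namespace Geometry

/-- `w` is a system of convex weights carried by the finite set `s`. -/
structure IsConvexWeight {E : Type*} (s : Finset E) (w : E → ℝ) : Prop where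
  nonneg : ∀ x, 0 ≤ w x
  eq_zero : ∀ x, x ∉ s → w x = 0
  sum_eq_one : ∑ x ∈ s, w x = 1

/-! ### Barycentric coordinates and uniqueness of convex combinations. -/

section Weights

variable {E : Type*} {s t : Finset E} {w w' : E → ℝ}

theorem IsConvexWeight.sum_mono {M : Type*} [AddCommMonoid M] [Module ℝ M]
    (hw : IsConvexWeight s w) (h : s ⊆ t) (g : E → M) :
    ∑ x ∈ t, w x • g x = ∑ x ∈ s, w x • g x :=
  (Finset.sum_subset h fun x _ hx => by rw [hw.eq_zero x hx, zero_smul]).symm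

theorem IsConvexWeight.mono (hw : IsConvexWeight s w) (h : s ⊆ t) : IsConvexWeight t w where
  nonneg := hw.nonneg
  eq_zero x hx := hw.eq_zero x fun h' => hx (h h')
  sum_eq_one := by
    rw [← hw.sum_eq_one]
    exact (Finset.sum_subset h fun x _ hx => hw.eq_zero x hx).symm

variable [AddCommGroup E] [Module ℝ E]

theorem mem_convexHull_iff_exists_isConvexWeight {x : E} :
    x ∈ convexHull ℝ (s : Set E) ↔ ∃ w, IsConvexWeight s w ∧ ∑ y ∈ s, w y • y = x := by
  classical
  rw [Finset.mem_convexHull']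
  constructor
  · rintro ⟨w, h0, h1, hx⟩
    refine ⟨fun y => if y ∈ s then w y else 0, ⟨fun y => ?_, fun y hy => by simp [hy], ?_⟩, ?_⟩
    · split_ifs with hy
      exacts [h0 y hy, le_rfl]
    · rw [← h1]
      exact Finset.sum_congr rfl fun y hy => by simp [hy]
    · rw [← hx]
      exact Finset.sum_congr rfl fun y hy => by simp [hy]
  · rintro ⟨w, hw, hx⟩
    exact ⟨w, fun y _ => hw.nonneg y, hw.sum_eq_one, hx⟩

theorem IsConvexWeight.eq_of_affineIndependent (hs : AffineIndependent ℝ ((↑) : s → E))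
    (hw : IsConvexWeight s w) (hw' : IsConvexWeight s w')
    (h : ∑ x ∈ s, w x • x = ∑ x ∈ s, w' x • x) : w = w' := by
  funext x
  by_cases hx : x ∈ s
  · have := affineIndependent_iff.mp hs s.attach (fun y => w y - w' y) ?_ ?_ ⟨x, hx⟩ (by simp)
    · exact sub_eq_zero.mp this
    · rw [Finset.sum_attach s (fun y => w y - w' y), Finset.sum_sub_distrib, hw.sum_eq_one,
        hw'.sum_eq_one, sub_self]
    · rw [Finset.sum_attach s (fun y => (w y - w' y) • y)]
      simp only [sub_smul, Finset.sum_sub_distrib, h, sub_self]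
  · rw [hw.eq_zero x hx, hw'.eq_zero x hx]

/-- An affine dependence, scaled down, can be added to the weights of the barycentre without moving
the point, so uniqueness forces the dependence to vanish. -/
theorem affineIndependent_of_isConvexWeight_unique (hs : s.Nonempty)
    (h : ∀ w w', IsConvexWeight s w → IsConvexWeight s w' →
      ∑ x ∈ s, w x • x = ∑ x ∈ s, w' x • x → w = w') :
    AffineIndependent ℝ ((↑) : s → E) := by
  classical
  rw [affineIndependent_iff_of_fintype]
  intro g hg0 hg1
  rw [Finset.weightedVSub_eq_linear_combination _ hg0] at hg1
  set G : E → ℝ := fun y => if hy : y ∈ s then g ⟨y, hy⟩ else 0 with hG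
  have hGs : ∀ i : s, G i = g i := fun i => by simp [hG]
  have hG0 : ∑ y ∈ s, G y = 0 := by
    rw [← Finset.sum_coe_sort, ← hg0]
    exact Finset.sum_congr rfl fun i _ => hGs i
  have hG1 : ∑ y ∈ s, G y • y = 0 := by
    rw [← Finset.sum_coe_sort s (fun y => G y • y), ← hg1]
    exact Finset.sum_congr rfl fun i _ => by rw [hGs]
  have hc : (0 : ℝ) < s.card := by exact_mod_cast hs.card_pos
  -- Dividing `G` by `s.card * A` makes it at most `1 / s.card` in absolute value, so the perturbed
  -- weights stay nonnegative.
  set A : ℝ := 1 + ∑ y ∈ s, |G y| with hA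
  have hApos : 0 < A := by
    have : 0 ≤ ∑ y ∈ s, |G y| := Finset.sum_nonneg fun _ _ => abs_nonneg _
    linarith
  have hw0 : IsConvexWeight s fun y => if y ∈ s then (s.card : ℝ)⁻¹ else 0 := by
    refine ⟨fun y => ?_, fun y hy => by simp [hy], ?_⟩
    · split_ifs <;> positivity
    · rw [Finset.sum_ite_mem, Finset.inter_self, Finset.sum_const, nsmul_eq_mul,
        mul_inv_cancel₀ hc.ne']
  have key := h _ (fun y => (if y ∈ s then (s.card : ℝ)⁻¹ else 0) + (s.card * A)⁻¹ * G y) hw0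
    ⟨fun y => ?_, fun y hy => by simp [hy, hG], ?_⟩ ?_
  · intro i
    have := congrFun key i
    have h2 : ((s.card : ℝ) * A)⁻¹ * G i = 0 := by linarith
    rcases mul_eq_zero.mp h2 with h3 | h3
    · exact absurd h3 (by positivity)
    · rw [← hGs, h3]
  · split_ifs with hy
    · have h1 : |G y| ≤ A := by
        have := Finset.single_le_sum (f := fun y => |G y|) (fun _ _ => abs_nonneg _) hy
        linarith
      have h2 : (s.card * A)⁻¹ * |G y| ≤ (s.card : ℝ)⁻¹ := by
        rw [mul_inv, mul_assoc]
        refine mul_le_of_le_one_right (by positivity) ?_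
        rw [inv_mul_le_iff₀ hApos]
        linarith
      have h3 : (s.card * A)⁻¹ * (-|G y|) ≤ (s.card * A)⁻¹ * G y :=
        mul_le_mul_of_nonneg_left (neg_abs_le _) (by positivity)
      linarith
    · simp [hG, hy]
  · rw [Finset.sum_add_distrib, ← Finset.mul_sum, hG0, mul_zero, add_zero, hw0.sum_eq_one]
  · simp only [add_smul, mul_smul, Finset.sum_add_distrib, ← Finset.smul_sum, hG1, smul_zero,
      add_zero]

end Weights

namespace SimplicialComplex

variable {E : Type*} [AddCommGroup E] [Module ℝ E]

/-- A common point of two simplices lies in the hull of `s ∩ t`; both weight systems agree with the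
one found there. The converse is `ofUniqueWeights`. -/
theorem eq_of_isConvexWeight (K : SimplicialComplex ℝ E) {s t : Finset E} (hs : s ∈ K.faces)
    (ht : t ∈ K.faces) {w w' : E → ℝ} (hw : IsConvexWeight s w) (hw' : IsConvexWeight t w')
    (h : ∑ x ∈ s, w x • x = ∑ x ∈ t, w' x • x) : w = w' := by
  classical
  have hx := K.inter_subset_convexHull hs ht
    ⟨mem_convexHull_iff_exists_isConvexWeight.mpr ⟨w, hw, rfl⟩,
      mem_convexHull_iff_exists_isConvexWeight.mpr ⟨w', hw', h.symm⟩⟩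
  rw [← Finset.coe_inter, mem_convexHull_iff_exists_isConvexWeight] at hx
  obtain ⟨v, hv, hvx⟩ := hx
  have h1 : w = v := hw.eq_of_affineIndependent (K.indep hs) (hv.mono Finset.inter_subset_left)
    (by rw [hv.sum_mono Finset.inter_subset_left fun x => x, hvx])
  have h2 : w' = v := hw'.eq_of_affineIndependent (K.indep ht) (hv.mono Finset.inter_subset_right)
    (by rw [hv.sum_mono Finset.inter_subset_right fun x => x, hvx, h])
  rw [h1, h2]

/-- A family of finite sets on which convex combinations are unique is a simplicial complex. -/
def ofUniqueWeights (F : Set (Finset E)) (hF : IsRelLowerSet F Finset.Nonempty)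
    (h : ∀ s ∈ F, ∀ t ∈ F, ∀ w w', IsConvexWeight s w → IsConvexWeight t w' →
      ∑ x ∈ s, w x • x = ∑ x ∈ t, w' x • x → w = w') : SimplicialComplex ℝ E where
  faces := F
  isRelLowerSet_faces := hF
  indep hs := affineIndependent_of_isConvexWeight_unique (hF hs).1 (h _ hs _ hs)
  inter_subset_convexHull := by
    classical
    rintro s t hs ht x ⟨hxs, hxt⟩
    obtain ⟨w, hw, hwx⟩ := mem_convexHull_iff_exists_isConvexWeight.mp hxs
    obtain ⟨w', hw', hwx'⟩ := mem_convexHull_iff_exists_isConvexWeight.mp hxt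
    obtain rfl := h s hs t ht w w' hw hw' (hwx.trans hwx'.symm)
    have h0 : ∀ y, y ∉ s ∩ t → w y = 0 := fun y hy => by
      by_cases hys : y ∈ s
      · exact hw'.eq_zero y fun hyt => hy (Finset.mem_inter.mpr ⟨hys, hyt⟩)
      · exact hw.eq_zero y hys
    have hwst : IsConvexWeight (s ∩ t) w := ⟨hw.nonneg, h0, by
      rw [← hw.sum_eq_one]
      exact Finset.sum_subset Finset.inter_subset_left fun y _ hy => h0 y hy⟩
    rw [← Finset.coe_inter, mem_convexHull_iff_exists_isConvexWeight]
    exact ⟨w, hwst, by rw [← hwx, hwst.sum_mono Finset.inter_subset_left fun y => y]⟩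

end SimplicialComplex

end Geometry

namespace Geometry.SimplicialComplex

/-! ### Subdivision of a complex at the midpoint of an edge. -/

section Bisect

variable {E : Type*} [AddCommGroup E] [Module ℝ E]

open Classical in
/-- The faces of the complex obtained from `K` by subdividing the edge `{u, v}` at its midpoint. -/
def bisectFaces (K : SimplicialComplex ℝ E) (u v : E) : Set (Finset E) :=
  {s | s.Nonempty ∧ ¬ (u ∈ s ∧ v ∈ s) ∧
    (s ∈ K.faces ∨ midpoint ℝ u v ∈ s ∧ s.erase (midpoint ℝ u v) ∪ {u, v} ∈ K.faces)}

theorem isRelLowerSet_bisectFaces (K : SimplicialComplex ℝ E) (u v : E) :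
    IsRelLowerSet (K.bisectFaces u v) Finset.Nonempty := by
  classical
  rintro s ⟨hs, huv, h⟩
  refine ⟨hs, fun t hts ht => ⟨ht, fun h' => huv ⟨hts h'.1, hts h'.2⟩, ?_⟩⟩
  rcases h with h | ⟨hm, h⟩
  · exact Or.inl (K.down_closed h hts ht)
  · by_cases hmt : midpoint ℝ u v ∈ t
    · exact Or.inr ⟨hmt, K.down_closed h
        (Finset.union_subset_union_left (Finset.erase_subset_erase _ hts)) (by simp)⟩
    · refine Or.inl (K.down_closed h (fun x hx => ?_) ht)
      exact Finset.mem_union_left _ (Finset.mem_erase.mpr ⟨fun e => hmt (e ▸ hx), hts hx⟩)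

theorem midpoint_mem_convexHull_pair (u v : E) : midpoint ℝ u v ∈ convexHull ℝ ({u, v} : Set E) := by
  rw [convexHull_pair]
  exact midpoint_mem_segment u v

theorem midpoint_notMem_of_mem_faces (K : SimplicialComplex ℝ E) {u v : E} (huv : u ≠ v)
    {e s : Finset E} (he : e ∈ K.faces) (hu : (u ∈ e)) (hv : v ∈ e) (hs : s ∈ K.faces) :
    midpoint ℝ u v ∉ s := by
  classical
  intro hm
  have h2 : ({u, v} : Finset E) ∈ K.faces :=
    K.down_closed he (by intro x; simp only [Finset.mem_insert, Finset.mem_singleton]; grind)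
      (by simp)
  have hmv : midpoint ℝ u v ∈ K.vertices := K.down_closed hs (by simpa using hm) (by simp)
  have := (K.vertex_mem_convexHull_iff hmv h2).mp
    (by simpa using midpoint_mem_convexHull_pair u v)
  simp only [Finset.mem_insert, Finset.mem_singleton] at this
  rcases this with h | h
  · exact huv (by simpa using h)
  · exact huv (by simpa using h)

open Classical in
/-- The weights with respect to `K` of a point given by weights with respect to the bisection. -/
noncomputable def bisectWeight (u v : E) (c : E → ℝ) (p : E) : ℝ :=
  if p = midpoint ℝ u v then 0
  else c p + c (midpoint ℝ u v) / 2 * ((if p = u then 1 else 0) + if p = v then 1 else 0)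

/-- Half of the midpoint's weight is moved to each of `u` and `v`, which leaves the point fixed. -/
theorem exists_isConvexWeight_bisectWeight (K : SimplicialComplex ℝ E) {u v : E} (huv : u ≠ v)
    {e s : Finset E} (he : e ∈ K.faces) (hu : (u ∈ e)) (hv : v ∈ e) (hs : s ∈ K.bisectFaces u v)
    {c : E → ℝ} (hc : IsConvexWeight s c) :
    ∃ t ∈ K.faces, IsConvexWeight t (bisectWeight u v c) ∧
      ∑ p ∈ t, bisectWeight u v c p • p = ∑ p ∈ s, c p • p := by
  classical
  obtain ⟨-, -, h | ⟨hms, h⟩⟩ := hs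
  · have hm := K.midpoint_notMem_of_mem_faces huv he hu hv h
    have hcm := hc.eq_zero _ hm
    have : bisectWeight u v c = c := by
      funext p
      rw [bisectWeight, hcm]
      split_ifs with hp <;> simp [hp, hcm]
    rw [this]
    exact ⟨s, h, hc, rfl⟩
  · have hm := K.midpoint_notMem_of_mem_faces huv he hu hv h
    set m := midpoint ℝ u v with hmdef
    set t := s.erase m ∪ {u, v} with ht
    have hut : u ∈ t := by simp [ht]
    have hvt : v ∈ t := by simp [ht]
    have hst : s ⊆ insert m t := fun x hx => by
      by_cases hxm : x = m <;> simp [ht, hxm, hx]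
    have hw : ∀ p ∈ t, bisectWeight u v c p =
        c p + c m / 2 * ((if p = u then 1 else 0) + if p = v then 1 else 0) := fun p hp =>
      if_neg (ne_of_mem_of_not_mem hp hm)
    have hc' := hc.mono hst
    refine ⟨t, h, ⟨fun p => ?_, fun p hp => ?_, ?_⟩, ?_⟩
    · rw [bisectWeight]
      have := hc.nonneg p
      have := hc.nonneg m
      split_ifs <;> positivity
    · rw [bisectWeight]
      split_ifs with h1 h2 h3 h3
      · rfl
      · exact absurd (h2 ▸ hut) hp
      · exact absurd (h2 ▸ hut) hp
      · exact absurd (h3 ▸ hvt) hp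
      · rw [hc'.eq_zero p (by simpa [hp] using h1), add_zero, mul_zero, add_zero]
    · have h1 := hc'.sum_eq_one
      rw [Finset.sum_insert hm] at h1
      rw [Finset.sum_congr rfl hw, Finset.sum_add_distrib, ← Finset.mul_sum,
        Finset.sum_add_distrib, Finset.sum_ite_eq' t u, Finset.sum_ite_eq' t v, if_pos hut,
        if_pos hvt]
      linarith
    · rw [← hc.sum_mono hst fun p => p, Finset.sum_insert hm]
      have : ∀ p ∈ t, bisectWeight u v c p • p = c p • p +
          ((if p = u then (c m / 2) • u else 0) + if p = v then (c m / 2) • v else 0) :=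
        fun p hp => by
          rw [hw p hp, add_smul, mul_add, add_smul]
          congr 2 <;> split_ifs with e <;> simp [e]
      rw [Finset.sum_congr rfl this, Finset.sum_add_distrib, Finset.sum_add_distrib,
        Finset.sum_ite_eq' t u, Finset.sum_ite_eq' t v, if_pos hut, if_pos hvt, add_comm]
      congr 1
      rw [hmdef, midpoint_eq_smul_add, smul_smul, ← smul_add]
      congr 1

theorem min_eq_zero_of_mem_bisectFaces (K : SimplicialComplex ℝ E) {u v : E} {s : Finset E}
    (hs : s ∈ K.bisectFaces u v) {c : E → ℝ} (hc : IsConvexWeight s c) : min (c u) (c v) = 0 := by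
  by_cases hu : u ∈ s
  · have hv : v ∉ s := fun hv => hs.2.1 ⟨hu, hv⟩
    rw [hc.eq_zero v hv]
    exact min_eq_right (hc.nonneg u)
  · rw [hc.eq_zero u hu]
    exact min_eq_left (hc.nonneg v)

/-- The bisection of the edge `{u, v}` of `K`. -/
noncomputable def bisect (K : SimplicialComplex ℝ E) {u v : E} (huv : u ≠ v)
    {e : Finset E} (he : e ∈ K.faces) (hu : (u ∈ e)) (hv : v ∈ e) : SimplicialComplex ℝ E :=
  ofUniqueWeights (K.bisectFaces u v) (K.isRelLowerSet_bisectFaces u v) <| by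
    intro s hs t ht c c' hc hc' h
    obtain ⟨s', hs', hw, hws⟩ := K.exists_isConvexWeight_bisectWeight huv he hu hv hs hc
    obtain ⟨t', ht', hw', hwt⟩ := K.exists_isConvexWeight_bisectWeight huv he hu hv ht hc'
    have key := K.eq_of_isConvexWeight hs' ht' hw hw' (by rw [hws, hwt, h])
    have hum : u ≠ midpoint ℝ u v := fun h => huv (by simpa using h)
    have hvm : v ≠ midpoint ℝ u v := fun h => huv (by simpa using h.symm)
    have h1 := congrFun key u
    have h2 := congrFun key v
    simp only [bisectWeight, if_neg hum, if_neg hvm, if_neg huv, if_neg huv.symm, if_pos] at h1 h2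
    have m1 := K.min_eq_zero_of_mem_bisectFaces hs hc
    have m2 := K.min_eq_zero_of_mem_bisectFaces ht hc'
    have := hc.nonneg u
    have := hc.nonneg v
    have := hc'.nonneg u
    have := hc'.nonneg v
    -- No face of the bisection contains both `u` and `v`, so the smaller of the two `K`-weights at
    -- `u`, `v` is exactly half of the midpoint's weight. This recovers `c` from its `K`-weights.
    have hm : c (midpoint ℝ u v) = c' (midpoint ℝ u v) := by
      rcases min_choice (c u) (c v) with e1 | e1 <;> rcases min_choice (c' u) (c' v) with e2 | e2 <;>
        rw [e1] at m1 <;> rw [e2] at m2 <;> linarith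
    funext p
    by_cases hp : p = midpoint ℝ u v
    · rw [hp, hm]
    · have h3 := congrFun key p
      simp only [bisectWeight, if_neg hp, hm] at h3
      linarith

variable {K : SimplicialComplex ℝ E} {u v : E} {huv : u ≠ v} {e : Finset E} {he : e ∈ K.faces}
  {hu : u ∈ e} {hv : v ∈ e}

theorem mem_bisect_faces {s : Finset E} :
    s ∈ (K.bisect huv he hu hv).faces ↔ s ∈ K.bisectFaces u v := Iff.rfl

theorem exists_convexHull_subset_of_mem_bisect {s : Finset E}
    (hs : s ∈ (K.bisect huv he hu hv).faces) :
    ∃ t ∈ K.faces, convexHull ℝ (s : Set E) ⊆ convexHull ℝ (t : Set E) := by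
  classical
  obtain ⟨-, -, h | ⟨hm, h⟩⟩ := mem_bisect_faces.mp hs
  · exact ⟨s, h, le_rfl⟩
  · refine ⟨_, h, convexHull_min (fun x hx => ?_) (convex_convexHull ℝ _)⟩
    by_cases hxm : x = midpoint ℝ u v
    · rw [hxm]
      refine convexHull_mono ?_ (midpoint_mem_convexHull_pair u v)
      simp [Set.insert_subset_iff]
    · exact subset_convexHull ℝ _ (by simpa [hxm] using Or.inr (Or.inr hx))

/-- Points of a simplex with edge `{u, v}` that are closer to `v` than to `u` in barycentric
coordinates lie in a simplex of the bisection. -/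
theorem exists_mem_bisect_of_weight_le {s : Finset E} (hs : s ∈ K.faces) (hus : u ∈ s)
    (hvs : v ∈ s) {w : E → ℝ} (hw : IsConvexWeight s w) (hle : w u ≤ w v) (huv : u ≠ v) :
    ∃ t ∈ K.bisectFaces u v, ∑ x ∈ s, w x • x ∈ convexHull ℝ (t : Set E) := by
  classical
  have hms : midpoint ℝ u v ∉ s := K.midpoint_notMem_of_mem_faces huv hs hus hvs hs
  -- With m the midpoint, w_u u + w_v v = 2 w_u m + (w_v − w_u) v, so `u` can be traded for m.
  refine ⟨insert (midpoint ℝ u v) (s.erase u), ⟨by simp, fun h => ?_, Or.inr ⟨by simp, ?_⟩⟩, ?_⟩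
  · have := h.1
    simp only [Finset.mem_insert, Finset.mem_erase, ne_eq, not_true_eq_false, false_and,
      or_false] at this
    exact huv (by simpa using this)
  · convert hs using 1
    ext x
    simp only [Finset.mem_union, Finset.mem_erase, Finset.mem_insert, Finset.mem_singleton]
    constructor
    · rintro (⟨h1, h2 | h2⟩ | h | h)
      exacts [absurd h2 h1, h2.2, h ▸ hus, h ▸ hvs]
    · intro hx
      have : x ≠ midpoint ℝ u v := fun h => hms (h ▸ hx)
      tauto
  · set s' := s.erase u
    have hvs' : v ∈ s' := Finset.mem_erase.mpr ⟨huv.symm, hvs⟩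
    have hm' : midpoint ℝ u v ∉ s' := fun h => hms (Finset.mem_of_mem_erase h)
    rw [Finset.mem_convexHull']
    refine ⟨fun x => if x = midpoint ℝ u v then 2 * w u else w x - if x = v then w u else 0,
      fun x _ => ?_, ?_, ?_⟩
    · have := hw.nonneg u
      have := hw.nonneg x
      beta_reduce
      split_ifs with h1 h2
      · positivity
      · rw [h2]; linarith
      · linarith
    · rw [Finset.sum_insert hm', if_pos rfl,
        Finset.sum_congr rfl fun x hx => if_neg (ne_of_mem_of_not_mem hx hm'), Finset.sum_sub_distrib,
        Finset.sum_ite_eq' s' v, if_pos hvs']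
      have := hw.sum_eq_one
      rw [← Finset.add_sum_erase s _ hus] at this
      linarith
    · beta_reduce
      rw [Finset.sum_insert hm', if_pos rfl, ← Finset.add_sum_erase s _ hus]
      have : ∀ x ∈ s', (if x = midpoint ℝ u v then 2 * w u else w x - if x = v then w u else 0) • x
          = w x • x - if x = v then w u • v else 0 := fun x hx => by
        rw [if_neg (ne_of_mem_of_not_mem hx hm'), sub_smul]
        congr 1
        split_ifs with h <;> simp [h]
      rw [Finset.sum_congr rfl this, Finset.sum_sub_distrib, Finset.sum_ite_eq' s' v, if_pos hvs',
        midpoint_eq_smul_add, smul_smul, invOf_eq_inv]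
      have : 2 * w u * (2 : ℝ)⁻¹ = w u := by ring
      rw [this, smul_add]
      abel

theorem bisectFaces_comm : K.bisectFaces u v = K.bisectFaces v u := by
  classical
  ext s
  simp only [bisectFaces, midpoint_comm (R := ℝ) u v, Finset.pair_comm u v, and_comm (a := u ∈ s),
    Set.mem_ofPred_eq]

theorem bisect_space : (K.bisect huv he hu hv).space = K.space := by
  classical
  ext x
  simp only [mem_space_iff]
  constructor
  · rintro ⟨s, hs, hx⟩
    obtain ⟨t, ht, hst⟩ := exists_convexHull_subset_of_mem_bisect hs
    exact ⟨t, ht, hst hx⟩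
  · rintro ⟨s, hs, hx⟩
    by_cases h : u ∈ s ∧ v ∈ s
    · obtain ⟨w, hw, rfl⟩ := mem_convexHull_iff_exists_isConvexWeight.mp hx
      rcases le_total (w u) (w v) with hle | hle
      · exact exists_mem_bisect_of_weight_le hs h.1 h.2 hw hle huv
      · have := exists_mem_bisect_of_weight_le hs h.2 h.1 hw hle huv.symm
        rwa [bisectFaces_comm] at this
    · exact ⟨s, ⟨K.nonempty_of_mem_faces hs, h, Or.inl hs⟩, hx⟩

theorem finite_bisect_faces (hK : K.faces.Finite) : (K.bisect huv he hu hv).faces.Finite := by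
  classical
  refine (hK.union (hK.biUnion fun t _ =>
    ((insert (midpoint ℝ u v) t).powerset.finite_toSet))).subset fun s hs => ?_
  obtain ⟨-, -, h | ⟨hm, h⟩⟩ := mem_bisect_faces.mp hs
  · exact Or.inl h
  · refine Or.inr (Set.mem_biUnion h ?_)
    rw [Finset.mem_coe, Finset.mem_powerset]
    intro x hx
    by_cases hxm : x = midpoint ℝ u v <;> simp [hxm, hx]

end Bisect

end Geometry.SimplicialComplex

namespace Geometry.SimplicialComplex

/-! ### Shrinking Euclidean edge lengths by repeated bisection. -/

section EdgeLength

variable {E H : Type*} [NormedAddCommGroup E] [NormedSpace ℝ E]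
  [NormedAddCommGroup H] [InnerProductSpace ℝ H]

theorem IsRefinement.refl {K : SimplicialComplex ℝ E} (hK : K.faces.Finite) : K.IsRefinement K :=
  ⟨hK, rfl, fun t ht => ⟨t, ht, le_rfl⟩⟩

theorem IsRefinement.trans {K₁ K₂ K₃ : SimplicialComplex ℝ E} (h₁₂ : K₁.IsRefinement K₂)
    (h₂₃ : K₂.IsRefinement K₃) : K₁.IsRefinement K₃ := by
  refine ⟨h₁₂.1, h₁₂.2.1.trans h₂₃.2.1, fun t ht => ?_⟩
  obtain ⟨s, hs, hts⟩ := h₁₂.2.2 t ht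
  obtain ⟨r, hr, hsr⟩ := h₂₃.2.2 s hs
  exact ⟨r, hr, hts.trans hsr⟩

theorem bisect_isRefinement {K : SimplicialComplex ℝ E} (hK : K.faces.Finite) {u v : E}
    (huv : u ≠ v) {e : Finset E} (he : e ∈ K.faces) (hu : u ∈ e) (hv : v ∈ e) :
    (K.bisect huv he hu hv).IsRefinement K :=
  ⟨finite_bisect_faces hK, bisect_space, fun _ ht => exists_convexHull_subset_of_mem_bisect ht⟩

/-- The ordered pairs of vertices of a common face. -/
def edgePairs (K : SimplicialComplex ℝ E) : Set (E × E) :=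
  {p | ∃ s ∈ K.faces, p.1 ∈ s ∧ p.2 ∈ s}

theorem finite_edgePairs {K : SimplicialComplex ℝ E} (hK : K.faces.Finite) :
    K.edgePairs.Finite := by
  refine (hK.biUnion fun s _ => (s.finite_toSet.prod s.finite_toSet)).subset ?_
  rintro p ⟨s, hs, h⟩
  exact Set.mem_biUnion hs h

theorem norm_sq_midpoint_sub (L : E →ₗ[ℝ] H) (u v b : E) :
    ‖L (midpoint ℝ u v) - L b‖ ^ 2 =
      (‖L u - L b‖ ^ 2 + ‖L v - L b‖ ^ 2) / 2 - ‖L u - L v‖ ^ 2 / 4 := by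
  have h := parallelogram_law_with_norm ℝ (L u - L b) (L v - L b)
  have h1 : L u - L b + (L v - L b) = (2 : ℝ) • (L (midpoint ℝ u v) - L b) := by
    rw [midpoint_eq_smul_add, invOf_eq_inv, map_smul, map_add, smul_sub, smul_smul]
    norm_num
    rw [two_smul]
    abel
  rw [h1, norm_smul, sub_sub_sub_cancel_right] at h
  norm_num at h
  linarith

/-- A new edge joins the midpoint to a vertex adjacent to both `u` and `v`, or is degenerate; the
median formula then bounds its length. -/
theorem mem_edgePairs_bisect {K : SimplicialComplex ℝ E} {u v : E}
    {huv : u ≠ v} {e : Finset E} {he : e ∈ K.faces} {hu : u ∈ e} {hv : v ∈ e} {p : E × E}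
    (hp : p ∈ (K.bisect huv he hu hv).edgePairs) :
    (p ∈ K.edgePairs ∧ p ≠ (u, v)) ∨
      (p.1 = midpoint ℝ u v ∨ (p.1, u) ∈ K.edgePairs ∧ (p.1, v) ∈ K.edgePairs) ∧
      (p.2 = midpoint ℝ u v ∨ (p.2, u) ∈ K.edgePairs ∧ (p.2, v) ∈ K.edgePairs) ∧
      (p.1 = midpoint ℝ u v ∨ p.2 = midpoint ℝ u v) := by
  classical
  obtain ⟨s, ⟨-, hs, h⟩, h1, h2⟩ := hp
  have hne : p ≠ (u, v) := by
    rintro rfl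
    exact hs ⟨h1, h2⟩
  rcases h with h | ⟨hm, h⟩
  · exact Or.inl ⟨⟨s, h, h1, h2⟩, hne⟩
  · have key : ∀ x ∈ s, x = midpoint ℝ u v ∨ x ∈ s.erase (midpoint ℝ u v) ∪ {u, v} := fun x hx => by
      by_cases hxm : x = midpoint ℝ u v <;> simp [hxm, hx]
    have key' : ∀ x ∈ s, x = midpoint ℝ u v ∨ (x, u) ∈ K.edgePairs ∧ (x, v) ∈ K.edgePairs :=
      fun x hx => (key x hx).imp_right fun h' => ⟨⟨_, h, h', by simp⟩, ⟨_, h, h', by simp⟩⟩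
    rcases key _ h1 with e1 | e1
    · exact Or.inr ⟨key' _ h1, key' _ h2, Or.inl e1⟩
    · rcases key _ h2 with e2 | e2
      · exact Or.inr ⟨key' _ h1, key' _ h2, Or.inr e2⟩
      · exact Or.inl ⟨⟨_, h, e1, e2⟩, hne⟩

/-- The median satisfies ‖m − b‖² ≤ R² − (0.9R)²/4 = 0.7975 R² < (0.9R)² when R > 0. The
parallelogram law is essential: in a general norm the median need not shrink. -/
theorem norm_midpoint_sub_le {L : E →ₗ[ℝ] H} {u v b : E} {R : ℝ} (hR : 0 ≤ R)
    (huv : 9 / 10 * R < ‖L u - L v‖) (hu : ‖L b - L u‖ ≤ R) (hv : ‖L b - L v‖ ≤ R) :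
    ‖L (midpoint ℝ u v) - L b‖ ≤ 9 / 10 * R := by
  refine le_of_sq_le_sq ?_ (by positivity)
  rw [norm_sq_midpoint_sub, norm_sub_rev (L u), norm_sub_rev (L v) (L b)]
  have := norm_nonneg (L b - L u)
  have := norm_nonneg (L b - L v)
  nlinarith

/-- Bisecting an edge longer than 9R/10 removes it and creates only edges of length at most 9R/10,
so the number of long edges drops; `N` bounds it for the induction. -/
theorem exists_isRefinement_edge_le (L : E →ₗ[ℝ] H) {R : ℝ} (hR : 0 ≤ R) (N : ℕ)
    (K : SimplicialComplex ℝ E) (hK : K.faces.Finite)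
    (hN : (K.edgePairs ∩ {p | 9 / 10 * R < ‖L p.1 - L p.2‖}).ncard ≤ N)
    (hL : ∀ p ∈ K.edgePairs, ‖L p.1 - L p.2‖ ≤ R) :
    ∃ K' : SimplicialComplex ℝ E, K'.IsRefinement K ∧
      ∀ p ∈ K'.edgePairs, ‖L p.1 - L p.2‖ ≤ 9 / 10 * R := by
  induction N generalizing K with
  | zero =>
    refine ⟨K, IsRefinement.refl hK, fun p hp => ?_⟩
    by_contra! h
    have := (Set.ncard_eq_zero ((finite_edgePairs hK).inter_of_left _)).mp (Nat.le_zero.mp hN)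
    exact (this ▸ (⟨hp, h⟩ : p ∈ K.edgePairs ∩ {p | 9 / 10 * R < ‖L p.1 - L p.2‖}) :
      p ∈ (∅ : Set (E × E)))
  | succ N ih =>
    by_cases hall : ∀ p ∈ K.edgePairs, ‖L p.1 - L p.2‖ ≤ 9 / 10 * R
    · exact ⟨K, IsRefinement.refl hK, hall⟩
    push Not at hall
    obtain ⟨⟨u, v⟩, ⟨e, he, hu, hv⟩, hlong⟩ := hall
    simp only at hu hv hlong
    have huv : u ≠ v := by
      rintro rfl
      rw [sub_self, norm_zero] at hlong
      linarith
    have hLuv : ‖L u - L v‖ ≤ R := hL (u, v) ⟨e, he, hu, hv⟩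
    have key : ∀ p ∈ (K.bisect huv he hu hv).edgePairs,
        (p ∈ K.edgePairs ∧ p ≠ (u, v)) ∨ ‖L p.1 - L p.2‖ ≤ 9 / 10 * R := by
      rintro ⟨a, b⟩ hp
      refine (mem_edgePairs_bisect hp).imp_right ?_
      rintro ⟨h1, h2, h3⟩
      simp only at h1 h2 h3 ⊢
      rcases h1 with rfl | h1
      · rcases h2 with rfl | h2
        · rw [sub_self, norm_zero]; positivity
        · exact norm_midpoint_sub_le hR hlong (hL _ h2.1) (hL _ h2.2)
      · rcases h3 with rfl | rfl
        · rcases h2 with rfl | h2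
          · rw [sub_self, norm_zero]; positivity
          · exact norm_midpoint_sub_le hR hlong (hL _ h2.1) (hL _ h2.2)
        · rw [norm_sub_rev]
          exact norm_midpoint_sub_le hR hlong (hL _ h1.1) (hL _ h1.2)
    have hcard : ((K.bisect huv he hu hv).edgePairs ∩
        {p | 9 / 10 * R < ‖L p.1 - L p.2‖}).ncard ≤ N := by
      refine Nat.lt_succ_iff.mp (lt_of_lt_of_le (Set.ncard_lt_ncard ?_
        ((finite_edgePairs hK).inter_of_left _)) hN)
      refine (Set.ssubset_iff_of_subset ?_).mpr ⟨(u, v), ⟨⟨e, he, hu, hv⟩, hlong⟩, ?_⟩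
      · rintro p ⟨hp, hpl⟩
        exact ⟨((key p hp).resolve_right (not_le.mpr hpl)).1, hpl⟩
      · rintro ⟨hp, hpl⟩
        exact ((key _ hp).resolve_right (not_le.mpr hpl)).2 rfl
    obtain ⟨K', hK', h⟩ := ih (K.bisect huv he hu hv) (finite_bisect_faces hK) hcard fun p hp => by
      rcases key p hp with h | h
      · exact hL p h.1
      · linarith
    exact ⟨K', hK'.trans (bisect_isRefinement hK huv he hu hv), h⟩

theorem exists_isRefinement_edge_le_pow (L : E →ₗ[ℝ] H) {R : ℝ} (hR : 0 ≤ R) (N : ℕ)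
    (K : SimplicialComplex ℝ E) (hK : K.faces.Finite)
    (hL : ∀ p ∈ K.edgePairs, ‖L p.1 - L p.2‖ ≤ R) :
    ∃ K' : SimplicialComplex ℝ E, K'.IsRefinement K ∧
      ∀ p ∈ K'.edgePairs, ‖L p.1 - L p.2‖ ≤ (9 / 10) ^ N * R := by
  induction N with
  | zero => exact ⟨K, IsRefinement.refl hK, by simpa using hL⟩
  | succ N ih =>
    obtain ⟨K₁, h₁, hL₁⟩ := ih
    obtain ⟨K₂, h₂, hL₂⟩ := exists_isRefinement_edge_le L (by positivity) _ K₁ h₁.1 le_rfl hL₁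
    refine ⟨K₂, h₂.trans h₁, fun p hp => (hL₂ p hp).trans_eq ?_⟩
    ring

end EdgeLength

/-! ### Refinements of arbitrarily small mesh in a normed space. -/

section Mesh

variable {E : Type*} [NormedAddCommGroup E] [NormedSpace ℝ E]

/-- On a finite-dimensional subspace the norm is dominated by a Euclidean seminorm on the whole
space. -/
theorem exists_euclidean_bound (V : Submodule ℝ E) [FiniteDimensional ℝ V] :
    ∃ (d : ℕ) (L : E →ₗ[ℝ] EuclideanSpace ℝ (Fin d)) (C : ℝ), 0 ≤ C ∧
      ∀ x ∈ V, ∀ y ∈ V, ‖x - y‖ ≤ C * ‖L x - L y‖ := by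
  obtain ⟨P, hP⟩ := Submodule.ClosedComplemented.of_finiteDimensional V
  refine ⟨_, (toEuclidean (E := V)).toLinearMap ∘ₗ P.toLinearMap,
    ‖((toEuclidean (E := V)).symm : EuclideanSpace ℝ (Fin (Module.finrank ℝ V)) →L[ℝ] V)‖, by positivity, fun x hx y hy => ?_⟩
  have := ((toEuclidean (E := V)).symm : EuclideanSpace ℝ (Fin (Module.finrank ℝ V)) →L[ℝ] V).le_opNorm
    (toEuclidean (P x) - toEuclidean (P y))
  rw [map_sub] at this
  have h1 := hP ⟨x, hx⟩
  have h2 := hP ⟨y, hy⟩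
  simp only at h1 h2
  simpa [h1, h2] using this

/-- Finite simplicial complexes have refinements of arbitrarily small mesh. -/
theorem exists_isRefinement_dist_le (K : SimplicialComplex ℝ E) (hK : K.faces.Finite) {η : ℝ}
    (hη : 0 < η) :
    ∃ K' : SimplicialComplex ℝ E, K'.IsRefinement K ∧
      ∀ s ∈ K'.faces, ∀ x ∈ convexHull ℝ (s : Set E), ∀ y ∈ convexHull ℝ (s : Set E),
        dist x y ≤ η := by
  have hfin : (⋃ s ∈ K.faces, (s : Set E)).Finite := hK.biUnion fun s _ => s.finite_toSet
  set V := Submodule.span ℝ (⋃ s ∈ K.faces, (s : Set E)) with hV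
  have : FiniteDimensional ℝ V := FiniteDimensional.span_of_finite ℝ hfin
  have hKV : K.space ⊆ V := by
    refine Set.iUnion₂_subset fun s hs => convexHull_min ?_ V.convex
    exact (Set.subset_biUnion_of_mem (u := fun s : Finset E => (s : Set E)) hs).trans
      Submodule.subset_span
  obtain ⟨d, L, C, hC, hLC⟩ := exists_euclidean_bound V
  obtain ⟨R, hR⟩ := ((finite_edgePairs hK).image fun p => ‖L p.1 - L p.2‖).bddAbove
  have hR' : ∀ p ∈ K.edgePairs, ‖L p.1 - L p.2‖ ≤ max R 0 := fun p hp =>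
    (hR (Set.mem_image_of_mem _ hp)).trans (le_max_left _ _)
  have hlim : Tendsto (fun N : ℕ => C * ((9 / 10 : ℝ) ^ N * max R 0)) atTop (𝓝 0) := by
    have := ((tendsto_pow_atTop_nhds_zero_of_lt_one (r := (9 / 10 : ℝ)) (by norm_num)
      (by norm_num)).mul_const (max R 0)).const_mul C
    simpa using this
  obtain ⟨N, hN⟩ := (hlim.eventually (gt_mem_nhds hη)).exists
  obtain ⟨K', hK', h⟩ := exists_isRefinement_edge_le_pow L (le_max_right R 0) N K hK hR'
  refine ⟨K', hK', fun s hs x hx y hy => ?_⟩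
  -- The diameter of a simplex is attained at vertices.
  obtain ⟨x', hx', y', hy', hle⟩ := convexHull_exists_dist_ge2 hx hy
  have hsV : (s : Set E) ⊆ V := (K'.subset_space hs).trans (hK'.2.1 ▸ hKV)
  calc dist x y ≤ dist x' y' := hle
    _ = ‖x' - y'‖ := dist_eq_norm _ _
    _ ≤ C * ‖L x' - L y'‖ := hLC _ (hsV hx') _ (hsV hy')
    _ ≤ C * ((9 / 10) ^ N * max R 0) :=
        mul_le_mul_of_nonneg_left (h (x', y') ⟨s, hs, hx', hy'⟩) hC
    _ ≤ η := hN.le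

end Mesh

end Geometry.SimplicialComplex

namespace Geometry.SimplicialComplex

/-! ### Subcomplexes and closures of their differences. -/

section Subcomplex

variable {E : Type*} [NormedAddCommGroup E] [NormedSpace ℝ E]

/-- The union of the simplices of `K` that belong to `A`. -/
def polyhedron (K : SimplicialComplex ℝ E) (A : Set (Finset E)) : Set E :=
  ⋃ s ∈ K.faces ∩ A, convexHull ℝ (s : Set E)

theorem mem_polyhedron {K : SimplicialComplex ℝ E} {A : Set (Finset E)} {x : E} :
    x ∈ K.polyhedron A ↔ ∃ s ∈ K.faces, s ∈ A ∧ x ∈ convexHull ℝ (s : Set E) := by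
  simp [polyhedron, and_assoc]

theorem isClosed_polyhedron {K : SimplicialComplex ℝ E} (hK : K.faces.Finite)
    (A : Set (Finset E)) : IsClosed (K.polyhedron A) :=
  (hK.inter_of_left A).isClosed_biUnion fun s _ =>
    (s.finite_toSet.isCompact_convexHull ℝ).isClosed

/-- A simplex which is not in a subcomplex lies in the closure of the complement of the
subcomplex. -/
theorem convexHull_subset_closure_diff {K : SimplicialComplex ℝ E} {B : Set (Finset E)}
    (hB : ∀ s ∈ B, ∀ t ⊆ s, t.Nonempty → t ∈ B) {s : Finset E} (hs : s ∈ K.faces) (hsB : s ∉ B) :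
    convexHull ℝ (s : Set E) ⊆ closure (convexHull ℝ (s : Set E) \ K.polyhedron B) := by
  classical
  intro x hx
  obtain ⟨w, hw, hwx⟩ := mem_convexHull_iff_exists_isConvexWeight.mp hx
  have hne := K.nonempty_of_mem_faces hs
  have hc : (0 : ℝ) < s.card := by exact_mod_cast hne.card_pos
  set b : E := ∑ y ∈ s, (s.card : ℝ)⁻¹ • y with hb
  -- Moving from `x` towards the barycentre `b` makes all weights on `s` positive. By uniqueness of
  -- weights a face `t` in `B` containing such a point contains `s`, which would put `s` in `B`.
  suffices h : openSegment ℝ x b ⊆ convexHull ℝ (s : Set E) \ K.polyhedron B from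
    closure_mono h (segment_subset_closure_openSegment (left_mem_segment ℝ x b))
  rintro z ⟨α, β, hα, hβ, hαβ, rfl⟩
  set W : E → ℝ := fun y => α * w y + if y ∈ s then β * (s.card : ℝ)⁻¹ else 0 with hW
  have hWw : IsConvexWeight s W := by
    refine ⟨fun y => ?_, fun y hy => by simp [hW, hy, hw.eq_zero y hy], ?_⟩
    · have := hw.nonneg y
      simp only [hW]
      split_ifs <;> positivity
    · simp only [hW]
      rw [Finset.sum_add_distrib, ← Finset.mul_sum, hw.sum_eq_one, Finset.sum_ite_mem,
        Finset.inter_self, Finset.sum_const, nsmul_eq_mul, mul_left_comm, mul_inv_cancel₀ hc.ne',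
        mul_one, mul_one, hαβ]
  have hWz : ∑ y ∈ s, W y • y = α • x + β • b := by
    rw [hb, ← hwx, Finset.smul_sum, Finset.smul_sum, ← Finset.sum_add_distrib]
    exact Finset.sum_congr rfl fun y hy => by simp [hW, hy, add_smul, mul_smul]
  refine ⟨mem_convexHull_iff_exists_isConvexWeight.mpr ⟨W, hWw, hWz⟩, fun hmem => hsB ?_⟩
  obtain ⟨t, ht, htB, hzt⟩ := mem_polyhedron.mp hmem
  obtain ⟨W', hW', hWz'⟩ := mem_convexHull_iff_exists_isConvexWeight.mp hzt
  have hWW := K.eq_of_isConvexWeight hs ht hWw hW' (hWz.trans hWz'.symm)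
  refine hB t htB s (fun y hy => ?_) hne
  by_contra hyt
  have h0 : W y = 0 := hWW ▸ hW'.eq_zero y hyt
  simp only [hW, if_pos hy] at h0
  have := mul_nonneg hα.le (hw.nonneg y)
  have : 0 < β * (s.card : ℝ)⁻¹ := by positivity
  linarith

theorem closure_polyhedron_diff {K : SimplicialComplex ℝ E} (hK : K.faces.Finite)
    {A B : Set (Finset E)} (hB : ∀ s ∈ B, ∀ t ⊆ s, t.Nonempty → t ∈ B) :
    closure (K.polyhedron A \ K.polyhedron B) = K.polyhedron (A \ B) := by
  apply Subset.antisymm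
  · refine closure_minimal ?_ (isClosed_polyhedron hK _)
    rintro x ⟨hxA, hxB⟩
    obtain ⟨s, hs, hsA, hx⟩ := mem_polyhedron.mp hxA
    exact mem_polyhedron.mpr
      ⟨s, hs, ⟨hsA, fun hsB => hxB (mem_polyhedron.mpr ⟨s, hs, hsB, hx⟩)⟩, hx⟩
  · intro x hx
    obtain ⟨s, hs, ⟨hsA, hsB⟩, hx⟩ := mem_polyhedron.mp hx
    refine closure_mono ?_ (convexHull_subset_closure_diff hB hs hsB hx)
    exact Set.sdiff_subset_sdiff_left fun y hy => mem_polyhedron.mpr ⟨s, hs, hsA, hy⟩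

/-- `A` need not be closed under passing to faces; adding all faces of its members does not change
the union. -/
theorem isSubcomplexSpace_polyhedron (K : SimplicialComplex ℝ E) (A : Set (Finset E)) :
    K.IsSubcomplexSpace (K.polyhedron A) := by
  refine ⟨⟨⟨{t | t ∈ K.faces ∧ ∃ s ∈ K.faces, s ∈ A ∧ t ⊆ s}, ?_⟩, fun hs => K.indep hs.1,
    fun hs ht => K.inter_subset_convexHull hs.1 ht.1⟩, fun t ht => ht.1, ?_⟩
  · rintro t ⟨ht, s, hs, hsA, hts⟩
    exact ⟨K.nonempty_of_mem_faces ht, fun r hrt hr =>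
      ⟨K.down_closed ht hrt hr, s, hs, hsA, Finset.Subset.trans hrt hts⟩⟩
  · ext x
    rw [mem_space_iff, mem_polyhedron]
    constructor
    · rintro ⟨t, ⟨-, s, hs, hsA, hts⟩, hx⟩
      exact ⟨s, hs, hsA, convexHull_mono (Finset.coe_subset.mpr hts) hx⟩
    · rintro ⟨s, hs, hsA, hx⟩
      exact ⟨s, ⟨hs, s, hs, hsA, Finset.Subset.refl s⟩, hx⟩

end Subcomplex

end Geometry.SimplicialComplex

/-! ### Rank, eigenvalue counts and the functional calculus of one matrix. -/

namespace Matrix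

variable {n : ℕ}

theorem isOpen_setOf_le_rank (m : ℕ) :
    IsOpen {A : Matrix (Fin n) (Fin n) ℂ | m ≤ A.rank} := by
  have hcont : Continuous fun A : Matrix (Fin n) (Fin n) ℂ =>
      LinearMap.toContinuousLinearMap (Matrix.toLin' A) :=
    (LinearMap.toContinuousLinearMap.toLinearMap ∘ₗ
      (Matrix.toLin' (R := ℂ) (m := Fin n) (n := Fin n)).toLinearMap).continuous_of_finiteDimensional
  convert (isOpen_setOfPred_nat_le_rank (𝕜 := ℂ) (E := Fin n → ℂ) (F := Fin n → ℂ) m).preimage hcont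
    using 1
  ext A
  simp only [Set.mem_ofPred_eq, Set.mem_preimage, LinearMap.coe_toContinuousLinearMap,
    LinearMap.rank, ← Module.finrank_eq_rank, Nat.cast_le]
  rfl

/-- The number of eigenvalues of the Hermitian matrix `A` in the set `U`, with multiplicity. -/
noncomputable def eigCount (A : Matrix (Fin n) (Fin n) ℂ) (U : Set ℝ) : ℕ :=
  (cfc (U.indicator fun _ => (1 : ℝ)) A).rank

theorem continuousOn_spectrum (A : Matrix (Fin n) (Fin n) ℂ) (g : ℝ → ℝ) :
    ContinuousOn g (spectrum ℝ A) :=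
  A.finite_real_spectrum.continuousOn g

variable {A : Matrix (Fin n) (Fin n) ℂ}

open Classical in
theorem IsHermitian.rank_cfc (hA : A.IsHermitian) (g : ℝ → ℝ) :
    (cfc g A).rank = (Finset.univ.filter fun i => g (hA.eigenvalues i) ≠ 0).card := by
  rw [hA.cfc_eq, IsHermitian.cfc, Unitary.conjStarAlgAut_apply,
    rank_mul_eq_left_of_isUnit_det, rank_mul_eq_right_of_isUnit_det, rank_diagonal,
    Fintype.card_subtype]
  · simp
  · exact (Matrix.isUnit_iff_isUnit_det _).mp (Unitary.isUnit_coe (U := hA.eigenvectorUnitary))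
  · exact (Matrix.isUnit_iff_isUnit_det _).mp (Unitary.isUnit_coe (U := hA.eigenvectorUnitary)).star

open Classical in
theorem IsHermitian.eigCount_eq (hA : A.IsHermitian) (U : Set ℝ) :
    A.eigCount U = (Finset.univ.filter fun i => hA.eigenvalues i ∈ U).card := by
  rw [eigCount, hA.rank_cfc]
  congr 1
  ext i
  simp

theorem IsHermitian.rank_cfc_eq_eigCount (hA : A.IsHermitian) {g : ℝ → ℝ} {U : Set ℝ}
    (h : ∀ t ∈ spectrum ℝ A, g t ≠ 0 ↔ t ∈ U) : (cfc g A).rank = A.eigCount U := by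
  classical
  rw [hA.rank_cfc, hA.eigCount_eq]
  congr 1
  ext i
  simpa using h _ (hA.spectrum_real_eq_range_eigenvalues ▸ Set.mem_range_self i)

theorem IsHermitian.eigCount_mono (hA : A.IsHermitian) {U V : Set ℝ} (h : U ⊆ V) :
    A.eigCount U ≤ A.eigCount V := by
  classical
  rw [hA.eigCount_eq, hA.eigCount_eq]
  exact Finset.card_le_card fun i hi => by simpa using h (by simpa using hi)

/-- Equal counts on nested sets leave no eigenvalue in between; this produces the spectral gaps. -/
theorem IsHermitian.mem_of_eigCount_le (hA : A.IsHermitian) {U V : Set ℝ} (h : U ⊆ V)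
    (hle : A.eigCount V ≤ A.eigCount U) {t : ℝ} (ht : t ∈ spectrum ℝ A) (htV : t ∈ V) : t ∈ U := by
  classical
  rw [hA.eigCount_eq, hA.eigCount_eq] at hle
  have := Finset.eq_of_subset_of_card_le
    (fun i hi => by simpa using h (by simpa using hi)) hle
  rw [hA.spectrum_real_eq_range_eigenvalues] at ht
  obtain ⟨i, rfl⟩ := ht
  have hi : i ∈ Finset.univ.filter fun i => hA.eigenvalues i ∈ V := by simpa using htV
  rw [← this] at hi
  simpa using hi

theorem IsHermitian.eigCount_add_compl (hA : A.IsHermitian) (U : Set ℝ) :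
    A.eigCount U + A.eigCount Uᶜ = n := by
  classical
  rw [hA.eigCount_eq, hA.eigCount_eq]
  simpa using Finset.card_filter_add_card_filter_not (s := Finset.univ)
    (fun i => hA.eigenvalues i ∈ U)

theorem isHermitian_of_nonneg (hA : 0 ≤ A) : A.IsHermitian :=
  IsSelfAdjoint.of_nonneg hA

theorem rank_eq_eigCount (hA : 0 ≤ A) : A.rank = A.eigCount (Ioi 0) := by
  have hH := isHermitian_of_nonneg hA
  rw [← hH.rank_cfc_eq_eigCount (g := fun t => t), cfc_id' ℝ A hH.isSelfAdjoint]
  intro t ht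
  exact ⟨fun h => (spectrum_nonneg_of_nonneg hA ht).lt_of_ne' h, fun h => (Set.mem_Ioi.mp h).ne'⟩

theorem IsHermitian.exists_le_eigCount_Ioi (hA : A.IsHermitian) {m : ℕ}
    (h : m ≤ A.eigCount (Ioi 0)) : ∃ c > 0, m ≤ A.eigCount (Ioi c) := by
  classical
  have h1 : ∀ᶠ c in 𝓝[>] (0 : ℝ), ∀ i, 0 < hA.eigenvalues i → c < hA.eigenvalues i := by
    refine eventually_all.mpr fun i => ?_
    by_cases hi : 0 < hA.eigenvalues i
    · filter_upwards [nhdsWithin_le_nhds (gt_mem_nhds hi)] with c hc _ using hc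
    · exact Eventually.of_forall fun c h => absurd h hi
  obtain ⟨c, hc, hc0⟩ := (h1.and self_mem_nhdsWithin).exists
  refine ⟨c, hc0, h.trans ?_⟩
  rw [hA.eigCount_eq, hA.eigCount_eq]
  exact Finset.card_le_card fun i hi => by simpa using hc i (by simpa using hi)

theorem isStarProjection_cfc {g : ℝ → ℝ} (h : ∀ t ∈ spectrum ℝ A, g t = 0 ∨ g t = 1) :
    IsStarProjection (cfc g A) := by
  refine ⟨?_, cfc_predicate g A⟩
  rw [IsIdempotentElem, ← cfc_mul g g A (continuousOn_spectrum A g) (continuousOn_spectrum A g)]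
  refine cfc_congr fun t ht => ?_
  rcases h t ht with e | e <;> simp [e]

/-- The spectrum is finite, so pointwise convergence of g(t)^(1/r) to 0 or 1 is already uniform. -/
theorem tendsto_cfc_rpow_one_div (hA : A.IsHermitian) {g φ : ℝ → ℝ}
    (hg : ∀ t ∈ spectrum ℝ A, 0 ≤ g t)
    (h : ∀ t ∈ spectrum ℝ A, g t = 0 ∧ φ t = 0 ∨ g t ≠ 0 ∧ φ t = 1) :
    Tendsto (fun r : ℝ => cfc g A ^ (1 / r)) atTop (𝓝 (cfc φ A)) := by
  have hrw : ∀ r : ℝ, cfc g A ^ (1 / r) = cfc (fun t => g t ^ (1 / r)) A := fun r => by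
    rw [CFC.rpow_eq_cfc_real (cfc_nonneg hg), ← cfc_comp' (fun t : ℝ => t ^ (1 / r)) g A
      ((A.finite_real_spectrum.image g).continuousOn _) (continuousOn_spectrum A g) hA.isSelfAdjoint]
  simp only [hrw]
  refine tendsto_cfc_fun ?_ (Eventually.of_forall fun r => continuousOn_spectrum A _)
  rw [Metric.tendstoUniformlyOn_iff]
  intro ε hε
  refine (A.finite_real_spectrum.eventually_all (l := atTop)).mpr fun t ht => ?_
  suffices H : Tendsto (fun r : ℝ => g t ^ (1 / r)) atTop (𝓝 (φ t)) by
    have := Metric.tendsto_nhds.mp H ε hε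
    simpa only [dist_comm] using this
  rcases h t ht with ⟨h0, h1⟩ | ⟨h0, h1⟩
  · rw [h0, h1]
    refine tendsto_const_nhds.congr' ?_
    filter_upwards [eventually_gt_atTop 0] with r hr
    rw [Real.zero_rpow (by positivity)]
  · rw [h1]
    have h2 : Tendsto (fun r : ℝ => 1 / r) atTop (𝓝 0) := by
      simpa using tendsto_inv_atTop_zero (𝕜 := ℝ)
    simpa [Function.comp_def] using (Real.continuousAt_const_rpow h0).tendsto.comp h2

end Matrix

/-! ### Continuous families of Hermitian matrices. -/

section Families

theorem tendstoUniformly_of_continuous_uncurry {X Y : Type*} [TopologicalSpace X]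
    [TopologicalSpace Y] [CompactSpace Y] {f : X → Y → ℝ}
    (hf : Continuous (Function.uncurry f)) (x : X) : TendstoUniformly f (f x) (𝓝 x) := by
  have h := (ContinuousMap.curry ⟨Function.uncurry f, hf⟩).continuous.tendsto x
  exact ContinuousMap.tendsto_iff_tendstoUniformly.mp h

variable {n : ℕ} {X : Type*} [TopologicalSpace X]

open Matrix

/-- Compactness puts all spectra in one compact interval, on which `h x` varies uniformly
continuously with `x`; joint continuity of the functional calculus applies. -/
theorem continuous_cfc_of_continuous_uncurry [CompactSpace X] {h : X → ℝ → ℝ}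
    (hh : Continuous (Function.uncurry h)) {a : X → Matrix (Fin n) (Fin n) ℂ} (ha : Continuous a)
    (hsa : ∀ x, (a x).IsHermitian) : Continuous fun x => cfc (h x) (a x) := by
  obtain ⟨M, hM⟩ := (isCompact_range ha).exists_bound_of_continuousOn continuousOn_id
  set s : Set ℝ := Metric.closedBall 0 (M * ‖(1 : Matrix (Fin n) (Fin n) ℂ)‖) with hs
  have hsc : IsCompact s := isCompact_closedBall _ _
  have hspec : ∀ x, spectrum ℝ (a x) ⊆ s := fun x t ht => by
    rw [hs, mem_closedBall_zero_iff]
    exact (spectrum.norm_le_norm_mul_of_mem ht).trans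
      (mul_le_mul_of_nonneg_right (hM _ (Set.mem_range_self x)) (norm_nonneg _))
  have hcs := continuousOn_cfc_setProd (𝕜 := ℝ) (A := Matrix (Fin n) (Fin n) ℂ)
    (p := IsSelfAdjoint) hsc
  have hcont : Continuous fun x => (UniformOnFun.ofFun {s} (h x), a x) := by
    refine Continuous.prodMk (continuous_iff_continuousAt.mpr fun x => ?_) ha
    rw [ContinuousAt, UniformOnFun.tendsto_iff_tendstoUniformlyOn]
    rintro _ rfl
    have : CompactSpace s := isCompact_iff_compactSpace.mp hsc
    rw [tendstoUniformlyOn_iff_tendstoUniformly_comp_coe]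
    exact tendstoUniformly_of_continuous_uncurry (f := fun y (t : s) => h y t)
      (hh.comp (continuous_id.prodMap continuous_subtype_val)) x
  exact hcs.comp_continuous hcont fun x =>
    ⟨(hh.comp (Continuous.prodMk_right x)).continuousOn, hsa x, hspec x⟩

variable {a : X → Matrix (Fin n) (Fin n) ℂ}

theorem isOpen_setOf_le_eigCount_Ioi [CompactSpace X] (ha : Continuous a)
    (hsa : ∀ x, (a x).IsHermitian) (m : ℕ) (t : ℝ) :
    IsOpen {x | m ≤ (a x).eigCount (Ioi t)} := by
  have hc : Continuous fun x => cfc (fun s : ℝ => max (s - t) 0) (a x) :=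
    continuous_cfc_of_continuous_uncurry (h := fun _ s => max (s - t) 0)
      (by unfold Function.uncurry; fun_prop) ha hsa
  convert (isOpen_setOf_le_rank m).preimage hc using 1
  ext x
  simp only [Set.mem_ofPred_eq, Set.mem_preimage]
  rw [(hsa x).rank_cfc_eq_eigCount (U := Ioi t)]
  intro s _
  simp

/-- Having few eigenvalues ≥ t means having many < t, and the latter is the rank of (t − a)₊, which
is lower semicontinuous. -/
theorem isOpen_setOf_eigCount_Ici_le [CompactSpace X] (ha : Continuous a)
    (hsa : ∀ x, (a x).IsHermitian) (m : ℕ) (t : ℝ) :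
    IsOpen {x | (a x).eigCount (Ici t) ≤ m} := by
  have hc : Continuous fun x => cfc (fun s : ℝ => max (t - s) 0) (a x) :=
    continuous_cfc_of_continuous_uncurry (h := fun _ s => max (t - s) 0)
      (by unfold Function.uncurry; fun_prop) ha hsa
  convert (isOpen_setOf_le_rank (n - m)).preimage hc using 1
  ext x
  simp only [Set.mem_ofPred_eq, Set.mem_preimage]
  rw [(hsa x).rank_cfc_eq_eigCount (U := (Ici t)ᶜ)]
  · have := (hsa x).eigCount_add_compl (Ici t)
    omega
  · intro s _
    simp

theorem IsCompact.exists_forall_le_eigCount_Ioi [CompactSpace X] (ha : Continuous a)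
    (hsa : ∀ x, (a x).IsHermitian) {m : ℕ} {Z : Set X} (hZ : IsCompact Z)
    (h : ∀ x ∈ Z, m ≤ (a x).eigCount (Ioi 0)) :
    ∃ c > 0, ∀ x ∈ Z, m ≤ (a x).eigCount (Ioi c) := by
  refine hZ.induction_on (p := fun Z => ∃ c > 0, ∀ x ∈ Z, m ≤ (a x).eigCount (Ioi c))
    ⟨1, one_pos, by simp⟩ ?_ ?_ ?_
  · rintro s t hst ⟨c, hc, H⟩
    exact ⟨c, hc, fun x hx => H x (hst hx)⟩
  · rintro s t ⟨c, hc, H⟩ ⟨d, hd, H'⟩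
    refine ⟨min c d, lt_min hc hd, fun x hx => ?_⟩
    rcases hx with hx | hx
    · exact (H x hx).trans ((hsa x).eigCount_mono (Ioi_subset_Ioi (min_le_left _ _)))
    · exact (H' x hx).trans ((hsa x).eigCount_mono (Ioi_subset_Ioi (min_le_right _ _)))
  · intro x hx
    obtain ⟨c, hc, H⟩ := (hsa x).exists_le_eigCount_Ioi (h x hx)
    exact ⟨_, nhdsWithin_le_nhds ((isOpen_setOf_le_eigCount_Ioi ha hsa m c).mem_nhds H), c, hc,
      fun y hy => hy⟩

end Families

/-! ### Choice of the thresholds δ_m. -/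

section Thresholds

open Matrix

variable {n : ℕ} {X : Type*} [TopologicalSpace X] [CompactSpace X]

theorem MatFun.apply_nonneg {X : Type*} [TopologicalSpace X] {a : MatFun n X} (ha : 0 ≤ a) (x : X) :
    0 ≤ a x :=
  ContinuousMap.le_def.mp ha x

theorem MatFun.isHermitian_apply {X : Type*} [TopologicalSpace X] {a : MatFun n X} (ha : 0 ≤ a)
    (x : X) : (a x).IsHermitian :=
  isHermitian_of_nonneg (apply_nonneg ha x)

theorem MatFun.le_of_mem_rankValues {X : Type*} [TopologicalSpace X] {a : MatFun n X} {m : ℕ}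
    (hm : m ∈ a.rankValues) : m ≤ n := by
  obtain ⟨x, rfl⟩ := hm
  simpa using (a x).rank_le_card_width

/-- The condition on `x` is closed, and forces rank ≥ m: a rank j < m would itself be a rank value,
with more than j positive eigenvalues. Compactness makes the positivity uniform. -/
theorem exists_threshold_step {a : MatFun n X} (ha : 0 ≤ a) (t : ℝ) (ht : 0 < t) :
    ∃ c > 0, ∀ m ∈ a.rankValues, ∀ x,
      (∀ j ∈ a.rankValues, j < m → j < (a x).eigCount (Ici t)) → m ≤ (a x).eigCount (Ioi c) := by
  have hsa := MatFun.isHermitian_apply ha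
  have key : ∀ m, ∃ c > 0, ∀ x, (∀ j ∈ a.rankValues, j < m → j < (a x).eigCount (Ici t)) →
      m ≤ (a x).eigCount (Ioi c) := fun m => by
    have hcl : IsClosed {x | ∀ j ∈ a.rankValues, j < m → j < (a x).eigCount (Ici t)} := by
      simp only [Set.ofPred_forall]
      refine isClosed_iInter fun j => isClosed_iInter fun _ => isClosed_iInter fun _ => ?_
      rw [← isOpen_compl_iff]
      convert isOpen_setOf_eigCount_Ici_le a.continuous hsa j t using 1
      ext x
      simp
    obtain ⟨c, hc, H⟩ := hcl.isCompact.exists_forall_le_eigCount_Ioi (m := m) a.continuous hsa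
      fun x hx => by
        rw [← rank_eq_eigCount (MatFun.apply_nonneg ha x)]
        by_contra! hlt
        have h1 := hx _ (Set.mem_range_self x) hlt
        have h2 := (hsa x).eigCount_mono (show Ici t ⊆ Ioi 0 from fun s hs => ht.trans_le hs)
        rw [← rank_eq_eigCount (MatFun.apply_nonneg ha x)] at h2
        exact absurd h1 (not_lt.mpr h2)
    exact ⟨c, hc, H⟩
  have hev : ∀ m ∈ Finset.range (n + 1), ∀ᶠ c in 𝓝[>] (0 : ℝ), ∀ x,
      (∀ j ∈ a.rankValues, j < m → j < (a x).eigCount (Ici t)) → m ≤ (a x).eigCount (Ioi c) := by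
    intro m _
    obtain ⟨c, hc, H⟩ := key m
    filter_upwards [nhdsWithin_le_nhds (gt_mem_nhds hc)] with d hd x hx
    exact (H x hx).trans ((hsa x).eigCount_mono (Ioi_subset_Ioi hd.le))
  obtain ⟨c, hc, hc0⟩ := (((Finset.eventually_all _).mpr hev).and self_mem_nhdsWithin).exists
  exact ⟨c, hc0, fun m hm => hc m
    (Finset.mem_range.mpr (Nat.lt_succ_of_le (MatFun.le_of_mem_rankValues hm)))⟩

theorem exists_thresholds {a : MatFun n X} (ha : 0 ≤ a) {η : ℝ} (hη : 0 < η) :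
    ∃ δ : ℕ → ℝ, (∀ m, 0 < δ m) ∧ Antitone δ ∧ δ 0 = η ∧ ∀ m ∈ a.rankValues, ∀ x,
      (∀ j ∈ a.rankValues, j < m → j < (a x).eigCount (Ioi (δ j / 2))) →
        m ≤ (a x).eigCount (Ioi (2 * δ m)) := by
  have hsa := MatFun.isHermitian_apply ha
  choose! c hc0 hc using exists_threshold_step ha
  -- The step is applied with t = δ_m / 2, and halving its output leaves room for 2δ_{m+1} ≤ c.
  let δ : ℕ → ℝ := fun m => Nat.rec η (fun _ d => min d (c (d / 2) / 2)) m
  have hsucc : ∀ m, δ (m + 1) = min (δ m) (c (δ m / 2) / 2) := fun m => rfl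
  have hpos : ∀ m, 0 < δ m := fun m => by
    induction m with
    | zero => exact hη
    | succ m ih =>
      rw [hsucc]
      exact lt_min ih (half_pos (hc0 _ (half_pos ih)))
  have hanti : Antitone δ := antitone_nat_of_succ_le fun m => (hsucc m).trans_le (min_le_left _ _)
  refine ⟨δ, hpos, hanti, rfl, fun m hm x hx => ?_⟩
  cases m with
  | zero => exact Nat.zero_le _
  | succ m =>
    have h1 := hc _ (half_pos (hpos m)) (m + 1) hm x fun j hj hjm =>
      (hx j hj hjm).trans_le ((hsa x).eigCount_mono fun s hs => by
        have := hanti (Nat.lt_succ_iff.mp hjm)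
        rw [Set.mem_Ioi] at hs
        rw [Set.mem_Ici]
        linarith)
    refine h1.trans ((hsa x).eigCount_mono (Ioi_subset_Ioi ?_))
    have := (hsucc m).trans_le (min_le_right _ _)
    linarith

/-- The chosen points, one for each rank value, keep their rank after the cutoff, so no rank value
is lost. -/
theorem exists_pos_forall_le_eigCount {X : Type*} [TopologicalSpace X] {a : MatFun n X} (ha : 0 ≤ a) {ε : ℝ} (hε : 0 < ε) :
    ∃ η > 0, 2 * η < ε ∧ ∀ m ∈ a.rankValues, ∃ x, (a x).rank = m ∧ m ≤ (a x).eigCount (Ioi η) := by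
  have hsa := MatFun.isHermitian_apply ha
  have hfin : a.rankValues.Finite := (Set.finite_Iic n).subset fun m hm =>
    MatFun.le_of_mem_rankValues hm
  have hev : ∀ m ∈ a.rankValues, ∀ᶠ c in 𝓝[>] (0 : ℝ),
      ∃ x, (a x).rank = m ∧ m ≤ (a x).eigCount (Ioi c) := by
    rintro _ ⟨x, rfl⟩
    obtain ⟨c, hc, H⟩ := (hsa x).exists_le_eigCount_Ioi
      (rank_eq_eigCount (MatFun.apply_nonneg ha x)).le
    filter_upwards [nhdsWithin_le_nhds (gt_mem_nhds hc)] with d hd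
    exact ⟨x, rfl, H.trans ((hsa x).eigCount_mono (Ioi_subset_Ioi hd.le))⟩
  obtain ⟨η, ⟨h1, h2⟩, h3⟩ := ((((hfin.eventually_all (l := 𝓝[>] (0 : ℝ))).mpr hev).and
    (nhdsWithin_le_nhds (gt_mem_nhds (half_pos hε)))).and self_mem_nhdsWithin).exists
  exact ⟨η, h3, by linarith, h1⟩

end Thresholds

/-! ### Scalar cutoff functions. -/

section Cutoff

/-- The piecewise linear function vanishing up to `d` and equal to `1` from `2 * d` on. -/
noncomputable def ramp (d t : ℝ) : ℝ := max 0 (min 1 (t / d - 1))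

variable {d t : ℝ}

theorem ramp_nonneg : 0 ≤ ramp d t := le_max_left _ _

theorem ramp_le_one : ramp d t ≤ 1 := max_le zero_le_one (min_le_left _ _)

theorem ramp_eq_zero (hd : 0 < d) (h : t ≤ d) : ramp d t = 0 := by
  refine max_eq_left ((min_le_right _ _).trans ?_)
  rw [sub_nonpos, div_le_one hd]
  exact h

theorem ramp_eq_one (hd : 0 < d) (h : 2 * d ≤ t) : ramp d t = 1 := by
  have : 1 ≤ t / d - 1 := by
    rw [le_sub_iff_add_le, le_div_iff₀ hd]
    linarith
  rw [ramp, min_eq_left this, max_eq_right zero_le_one]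

theorem ramp_anti {d' : ℝ} (hd : 0 < d) (hdd' : d ≤ d') (ht : 0 ≤ t) : ramp d' t ≤ ramp d t := by
  unfold ramp
  gcongr

theorem continuous_ramp : Continuous (ramp d) := by
  unfold ramp
  fun_prop

/-- Interpolation between `1` and `ramp d t`. -/
noncomputable def cutoff (d θ t : ℝ) : ℝ := θ + (1 - θ) * ramp d t

variable {θ : ℝ}

theorem cutoff_mem_Icc (h0 : 0 ≤ θ) (h1 : θ ≤ 1) : cutoff d θ t ∈ Icc (0 : ℝ) 1 := by
  have := ramp_nonneg (d := d) (t := t)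
  have := ramp_le_one (d := d) (t := t)
  constructor <;> unfold cutoff <;> nlinarith

theorem cutoff_eq_one (hd : 0 < d) (h : 2 * d ≤ t) : cutoff d θ t = 1 := by
  rw [cutoff, ramp_eq_one hd h]
  ring

theorem cutoff_pos (h0 : 0 < θ) (h1 : θ ≤ 1) : 0 < cutoff d θ t := by
  have := ramp_nonneg (d := d) (t := t)
  unfold cutoff
  nlinarith

theorem cutoff_eq_zero (hd : 0 < d) (h : t ≤ d) : cutoff d 0 t = 0 := by
  rw [cutoff, ramp_eq_zero hd h]
  ring

/-- The product of `t` with the cutoffs for the indices in `S`. -/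
noncomputable def cutoffProd (S : Finset ℕ) (δ θ : ℕ → ℝ) (t : ℝ) : ℝ :=
  t * ∏ m ∈ S, cutoff (δ m) (θ m) t

variable {S : Finset ℕ} {δ Θ : ℕ → ℝ}

theorem cutoffProd_mem_Icc (hΘ : ∀ m, Θ m ∈ Icc (0 : ℝ) 1) (ht : 0 ≤ t) :
    cutoffProd S δ Θ t ∈ Icc 0 t := by
  have h := fun m => cutoff_mem_Icc (d := δ m) (t := t) (hΘ m).1 (hΘ m).2
  exact ⟨mul_nonneg ht (Finset.prod_nonneg fun m _ => (h m).1),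
    mul_le_of_le_one_right ht (Finset.prod_le_one (fun m _ => (h m).1) fun m _ => (h m).2)⟩

theorem cutoffProd_eq_self (hδ : ∀ m, 0 < δ m) (h : ∀ m ∈ S, 2 * δ m ≤ t) :
    cutoffProd S δ Θ t = t := by
  rw [cutoffProd, Finset.prod_eq_one fun m hm => cutoff_eq_one (hδ m) (h m hm), mul_one]

theorem cutoffProd_eq_zero (hδ : ∀ m, 0 < δ m) {m : ℕ} (hm : m ∈ S) (hΘ : Θ m = 0) (h : t ≤ δ m) :
    cutoffProd S δ Θ t = 0 := by
  rw [cutoffProd, Finset.prod_eq_zero hm (by rw [hΘ, cutoff_eq_zero (hδ m) h]), mul_zero]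

theorem cutoffProd_pos (hδ : ∀ m, 0 < δ m) (hδa : Antitone δ) (hΘ : ∀ m, Θ m ∈ Icc (0 : ℝ) 1)
    {m : ℕ} (hm : ∀ j ∈ S, j < m → 0 < Θ j) (h : 2 * δ m ≤ t) : 0 < cutoffProd S δ Θ t := by
  have := hδ m
  refine mul_pos (by linarith) (Finset.prod_pos fun j hj => ?_)
  rcases lt_or_ge j m with hjm | hjm
  · exact cutoff_pos (hm j hj hjm) (hΘ j).2
  · rw [cutoff_eq_one (hδ j) (by have := hδa hjm; linarith)]
    exact one_pos

theorem abs_cutoffProd_sub_le (hδ : ∀ m, 0 < δ m) (hδa : Antitone δ)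
    (hΘ : ∀ m, Θ m ∈ Icc (0 : ℝ) 1) (ht : 0 ≤ t) : |cutoffProd S δ Θ t - t| ≤ 2 * δ 0 := by
  rcases le_total (2 * δ 0) t with h | h
  · rw [cutoffProd_eq_self hδ fun m _ => by have := hδa (Nat.zero_le m); linarith]
    simpa using (hδ 0).le
  · have := cutoffProd_mem_Icc (S := S) (δ := δ) hΘ ht
    rw [abs_le]
    constructor <;> linarith [this.1, this.2]

end Cutoff

/-! ### The well supported element attached to a stratification. -/

section Stratification

open Matrix

variable {n : ℕ} {X : Type*}

/-- The part of `V m` outside the sets `V j` with smaller index `j ∈ S`. -/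
def stratum (S : Set ℕ) (V : ℕ → Set X) (m : ℕ) : Set X :=
  {x | x ∈ V m ∧ ∀ j ∈ S, j < m → x ∉ V j}

theorem exists_mem_stratum {S : Set ℕ} {V : ℕ → Set X} {x : X} (h : ∃ m ∈ S, x ∈ V m) :
    ∃ m ∈ S, x ∈ stratum S V m := by
  classical
  obtain ⟨h1, h2⟩ := Nat.find_spec h
  exact ⟨Nat.find h, h1, h2, fun j hj hlt hx => Nat.find_min h hlt ⟨hj, hx⟩⟩

/-- If `V` stratifies `X` compatibly with the spectral gaps of `a`, cutting off the small
eigenvalues of `a` gives a well supported element whose rank sets are the strata of `V`. -/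
theorem exists_isWellSupported_of_stratification [MetricSpace X] [CompactSpace X]
    {a : MatFun n X} (ha : 0 ≤ a) {ε : ℝ} {δ : ℕ → ℝ} (hδ : ∀ m, 0 < δ m) (hδa : Antitone δ)
    (hδε : 2 * δ 0 < ε) {V : ℕ → Set X} (hVc : ∀ m, IsClosed (V m))
    (hV : ∀ m ∈ a.rankValues, ∀ x ∈ V m, (a x).eigCount (Ici (δ m)) ≤ m)
    (hV' : ∀ m ∈ a.rankValues, ∀ x ∉ V m, m < (a x).eigCount (Ioi (δ m / 2)))
    (hcl : ∀ m ∈ a.rankValues, ∀ x ∈ closure (stratum a.rankValues V m),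
      m ≤ (a x).eigCount (Ioi (2 * δ m)))
    (hne : ∀ m ∈ a.rankValues, ∃ x, (a x).rank = m ∧ m ≤ (a x).eigCount (Ioi (δ 0))) :
    ∃ f : MatFun n X, 0 ≤ f ∧ f.IsWellSupported ∧ f ≤ a ∧ ‖f - a‖ < ε ∧
      f.rankValues = a.rankValues ∧
      ∀ m ∈ a.rankValues, f.rankSet m = stratum a.rankValues V m := by
  classical
  have hsa := MatFun.isHermitian_apply ha
  have hspec : ∀ x, ∀ t ∈ spectrum ℝ (a x), 0 ≤ t := fun x t ht =>
    spectrum_nonneg_of_nonneg (MatFun.apply_nonneg ha x) ht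
  have hrankV : ∀ x, x ∈ V (a x).rank := fun x => by
    by_contra h
    have h1 := hV' _ (Set.mem_range_self x) x h
    have h2 := (hsa x).eigCount_mono (Ioi_subset_Ioi (half_pos (hδ (a x).rank)).le)
    rw [← rank_eq_eigCount (MatFun.apply_nonneg ha x)] at h2
    exact absurd h1 (not_lt.mpr h2)
  have hVne : ∀ m ∈ a.rankValues, (V m).Nonempty := by
    rintro _ ⟨x, rfl⟩
    exact ⟨x, hrankV x⟩
  set S : Finset ℕ := (Finset.range (n + 1)).filter (· ∈ a.rankValues) with hS
  have hmS : ∀ m, m ∈ S ↔ m ∈ a.rankValues := fun m => by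
    rw [hS, Finset.mem_filter, Finset.mem_range]
    exact ⟨fun h => h.2, fun h => ⟨Nat.lt_succ_of_le (MatFun.le_of_mem_rankValues h), h⟩⟩
  -- `infDist` to the empty set is 0, so positivity off `V m` needs `hVne`; this is why only rank
  -- values enter `S`.
  set θ : X → ℕ → ℝ := fun x m => min 1 (Metric.infDist x (V m)) with hθ
  have hθI : ∀ x m, θ x m ∈ Icc (0 : ℝ) 1 := fun x m =>
    ⟨le_min zero_le_one Metric.infDist_nonneg, min_le_left _ _⟩
  have hθ0 : ∀ x m, x ∈ V m → θ x m = 0 := fun x m hx => by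
    simp only [hθ, Metric.infDist_zero_of_mem hx]
    exact min_eq_right zero_le_one
  have hθpos : ∀ x, ∀ m ∈ a.rankValues, x ∉ V m → 0 < θ x m := fun x m hm hx =>
    lt_min one_pos (((hVc m).notMem_iff_infDist_pos (hVne m hm)).mp hx)
  set h : X → ℝ → ℝ := fun x => cutoffProd S δ (θ x) with hh
  have hcont : Continuous (Function.uncurry h) := by
    simp only [hh, hθ, Function.uncurry_def, cutoffProd, cutoff]
    refine continuous_snd.mul (continuous_finsetProd _ fun m _ => ?_)
    have h1 : Continuous fun p : X × ℝ => ramp (δ m) p.2 := continuous_ramp.comp continuous_snd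
    have h2 : Continuous fun p : X × ℝ => Metric.infDist p.1 (V m) :=
      (Metric.continuous_infDist_pt _).comp continuous_fst
    fun_prop
  set f : MatFun n X := ⟨fun x => cfc (h x) (a x),
    continuous_cfc_of_continuous_uncurry hcont a.continuous hsa⟩ with hf
  have hfx : ∀ x, f x = cfc (h x) (a x) := fun x => rfl
  have hmem : ∀ m ∈ a.rankValues, ∀ x ∈ closure (stratum a.rankValues V m), x ∈ V m :=
    fun m _ x hx => closure_minimal (fun y hy => hy.1) (hVc m) hx
  -- At most m eigenvalues are ≥ δ_m and at least m are > 2δ_m, so none lies between.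
  have hgap : ∀ m ∈ a.rankValues, ∀ x ∈ closure (stratum a.rankValues V m),
      ∀ t ∈ spectrum ℝ (a x), t ≤ δ m ∨ 2 * δ m < t := by
    intro m hm x hx t ht
    by_contra! hlt
    have := (hsa x).mem_of_eigCount_le (U := Ioi (2 * δ m)) (V := Ici (δ m))
      (fun s hs => by
        have := hδ m
        rw [Set.mem_Ioi] at hs
        rw [Set.mem_Ici]
        linarith)
      ((hV m hm x (hmem m hm x hx)).trans (hcl m hm x hx)) ht hlt.1.le
    exact absurd this (not_lt.mpr hlt.2)
  have hlow : ∀ m ∈ a.rankValues, ∀ x ∈ stratum a.rankValues V m, ∀ t ≤ δ m, h x t = 0 :=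
    fun m hm x hx t ht => cutoffProd_eq_zero hδ ((hmS m).mpr hm) (hθ0 x m hx.1) ht
  have hhigh : ∀ m ∈ a.rankValues, ∀ x ∈ stratum a.rankValues V m, ∀ t, 2 * δ m < t → 0 < h x t :=
    fun m hm x hx t ht => cutoffProd_pos hδ hδa (hθI x)
      (fun j hj hjm => hθpos x j ((hmS j).mp hj) (hx.2 j ((hmS j).mp hj) hjm)) ht.le
  have hrank : ∀ m ∈ a.rankValues, ∀ x ∈ stratum a.rankValues V m, (f x).rank = m := by
    intro m hm x hx
    have hx' := subset_closure hx
    rw [hfx, (hsa x).rank_cfc_eq_eigCount (U := Ioi (2 * δ m))]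
    · refine le_antisymm (((hsa x).eigCount_mono fun s hs => ?_).trans (hV m hm x hx.1))
        (hcl m hm x hx')
      have := hδ m
      rw [Set.mem_Ioi] at hs
      rw [Set.mem_Ici]
      linarith
    · intro t ht
      rcases hgap m hm x hx' t ht with h1 | h1
      · have := hδ m
        rw [hlow m hm x hx t h1]
        simp only [ne_eq, not_true_eq_false, Set.mem_Ioi, false_iff, not_lt]
        linarith
      · exact iff_of_true (hhigh m hm x hx t h1).ne' h1
  have hex : ∀ x, ∃ m ∈ a.rankValues, x ∈ stratum a.rankValues V m := fun x =>
    exists_mem_stratum ⟨_, Set.mem_range_self x, hrankV x⟩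
  have hset : ∀ m ∈ a.rankValues, f.rankSet m = stratum a.rankValues V m := by
    intro m hm
    refine Subset.antisymm (fun x hx => ?_) fun x hx => hrank m hm x hx
    obtain ⟨m', hm', hx'⟩ := hex x
    have h1 : m' = m := (hrank m' hm' x hx').symm.trans hx
    exact h1 ▸ hx'
  have hvals : f.rankValues = a.rankValues := by
    refine Subset.antisymm ?_ fun m hm => ?_
    · rintro _ ⟨x, rfl⟩
      obtain ⟨m, hm, hx⟩ := hex x
      simpa only [hrank m hm x hx] using hm
    -- With m eigenvalues above δ_0 ≥ δ_j, this point cannot lie in `V j` for j < m.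
    · obtain ⟨x, hx, hxm⟩ := hne m hm
      refine ⟨x, hrank m hm x ⟨hx ▸ hrankV x, fun j hj hjm hxj => ?_⟩⟩
      have h1 := hV j hj x hxj
      have h2 := (hsa x).eigCount_mono (show Ioi (δ 0) ⊆ Ici (δ j) from fun s hs =>
        (hδa (Nat.zero_le j)).trans (le_of_lt hs))
      omega
  have hIcc : ∀ x, ∀ t ∈ spectrum ℝ (a x), h x t ∈ Icc 0 t := fun x t ht =>
    cutoffProd_mem_Icc (hθI x) (hspec x t ht)
  refine ⟨f, ContinuousMap.le_def.mpr fun x => cfc_nonneg fun t ht => (hIcc x t ht).1, ?_,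
    ContinuousMap.le_def.mpr fun x => ?_, ?_, hvals, hset⟩
  -- The projection is defined by one fixed function of `a`, hence extends continuously; the gap
  -- makes it idempotent on the closure.
  · refine ⟨fun m => ⟨fun x => cfc (ramp (δ m)) (a x), ?_⟩, fun m => ?_, fun m x hx => ?_,
      fun i j hij x hi hj => ?_⟩
    · have hc : Continuous fun x => cfc (ramp (δ m)) (a x) :=
        continuous_cfc_of_continuous_uncurry (h := fun _ => ramp (δ m))
          (continuous_ramp.comp continuous_snd) a.continuous hsa
      exact hc.comp continuous_subtype_val
    · have hm : (m : ℕ) ∈ a.rankValues := hvals ▸ m.2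
      have key : ∀ x : closure (f.rankSet m), IsStarProjection (cfc (ramp (δ m)) (a x)) := by
        rintro ⟨x, hx⟩
        rw [hset m hm] at hx
        refine isStarProjection_cfc fun t ht => ?_
        exact (hgap m hm x hx t ht).imp (ramp_eq_zero (hδ m)) fun h1 => ramp_eq_one (hδ m) h1.le
      exact ⟨ContinuousMap.ext fun x => (key x).isIdempotentElem,
        ContinuousMap.ext fun x => (key x).isSelfAdjoint⟩
    · have hm : (m : ℕ) ∈ a.rankValues := hvals ▸ m.2
      rw [hset m hm] at hx
      refine tendsto_cfc_rpow_one_div (hsa x) (fun t ht => (hIcc x t ht).1) fun t ht => ?_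
      rcases hgap m hm x (subset_closure hx) t ht with h1 | h1
      · exact Or.inl ⟨hlow m hm x hx t h1, ramp_eq_zero (hδ m) h1⟩
      · exact Or.inr ⟨(hhigh m hm x hx t h1).ne', ramp_eq_one (hδ m) h1.le⟩
    · exact cfc_mono (fun t ht => ramp_anti (hδ j) (hδa hij) (hspec x t ht))
        (continuousOn_spectrum _ _) (continuousOn_spectrum _ _)
  · calc f x ≤ cfc (fun t : ℝ => t) (a x) :=
          cfc_mono (fun t ht => (hIcc x t ht).2) (continuousOn_spectrum _ _)
            (continuousOn_spectrum _ _)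
      _ = a x := cfc_id' ℝ (a x) (hsa x).isSelfAdjoint
  · refine lt_of_le_of_lt ((ContinuousMap.norm_le _ (by linarith [hδ 0])).mpr fun x => ?_) hδε
    have h1 : (f - a) x = cfc (fun t => h x t - t) (a x) := by
      rw [cfc_sub (h x) (fun t => t) (a x) (continuousOn_spectrum _ _) (continuousOn_spectrum _ _),
        cfc_id' ℝ (a x) (hsa x).isSelfAdjoint]
      rfl
    rw [h1]
    exact norm_cfc_le (by linarith [hδ 0]) fun t ht =>
      abs_cutoffProd_sub_le hδ hδa (hθI x) (hspec x t ht)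

end Stratification

/-! ### Refinements subordinate to open covers. -/

namespace Geometry.SimplicialComplex

variable {E : Type*} [NormedAddCommGroup E] [NormedSpace ℝ E]

/-- Finitely many two-element open covers of the polyhedron of a finite complex are refined by the
simplices of some refinement of the complex. -/
theorem exists_isRefinement_subordinate (K : SimplicialComplex ℝ E) [Finite K.faces] (N : ℕ)
    {U W : ℕ → Set K.space} (hU : ∀ m, IsOpen (U m)) (hW : ∀ m, IsOpen (W m))
    (hUW : ∀ m, U m ∪ W m = univ) :
    ∃ K' : SimplicialComplex ℝ E, K'.IsRefinement K ∧ ∀ m ≤ N, ∀ s ∈ K'.faces,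
      (∀ x : K.space, (x : E) ∈ convexHull ℝ (s : Set E) → x ∈ U m) ∨
      (∀ x : K.space, (x : E) ∈ convexHull ℝ (s : Set E) → x ∈ W m) := by
  have hleb : ∀ m ∈ Finset.range (N + 1), ∀ᶠ r in 𝓝[>] (0 : ℝ),
      ∀ x : K.space, Metric.closedBall x r ⊆ U m ∨ Metric.closedBall x r ⊆ W m := by
    intro m _
    obtain ⟨r, hr, H⟩ := lebesgue_number_lemma_of_metric (c := fun b : Bool => cond b (U m) (W m))
      (isCompact_univ (X := K.space)) (by rintro (_ | _) <;> simp [hU, hW])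
      (fun x _ => by
        have hx : x ∈ U m ∪ W m := hUW m ▸ mem_univ x
        rcases hx with hx | hx
        · exact mem_iUnion.mpr ⟨true, hx⟩
        · exact mem_iUnion.mpr ⟨false, hx⟩)
    filter_upwards [nhdsWithin_le_nhds (gt_mem_nhds hr)] with q hq x
    obtain ⟨b, hb⟩ := H x (mem_univ x)
    have hb' := (Metric.closedBall_subset_ball hq).trans hb
    cases b
    · exact Or.inr hb'
    · exact Or.inl hb'
  obtain ⟨r, hr, hr0⟩ := (((Finset.eventually_all _).mpr hleb).and self_mem_nhdsWithin).exists
  obtain ⟨K', hK', hmesh⟩ := K.exists_isRefinement_dist_le (Set.toFinite _) hr0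
  refine ⟨K', hK', fun m hm s hs => ?_⟩
  obtain ⟨v, hv⟩ := K'.nonempty_of_mem_faces hs
  have hvs : v ∈ convexHull ℝ (s : Set E) := subset_convexHull ℝ _ hv
  have hvK : v ∈ K.space := hK'.2.1 ▸ convexHull_subset_space hs hvs
  have hball : ∀ x : K.space, (x : E) ∈ convexHull ℝ (s : Set E) →
      x ∈ Metric.closedBall (⟨v, hvK⟩ : K.space) r := fun x hx => hmesh s hs x hx v hvs
  exact (hr m (Finset.mem_range.mpr (Nat.lt_succ_of_le hm)) ⟨v, hvK⟩).imp
    (fun h x hx => h (hball x hx)) fun h x hx => h (hball x hx)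

end Geometry.SimplicialComplex

/-! ### Assembly of the theorem. -/

open Geometry.SimplicialComplex in
theorem mainTheorem4 {E : Type*} [NormedAddCommGroup E] [NormedSpace ℝ E]
    (K : Geometry.SimplicialComplex ℝ E) [Finite K.faces] (n : ℕ)
    (a : MatFun n K.space) (ha : 0 ≤ a) (ε : ℝ) (hε : 0 < ε) :
    ∃ f : MatFun n K.space,
      0 ≤ f ∧ f.IsWellSupported ∧ f ≤ a ∧ ‖f - a‖ < ε ∧
      f.rankValues = a.rankValues ∧
      ∃ K' : Geometry.SimplicialComplex ℝ E, K'.IsRefinement K ∧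
        ∀ m ∈ f.rankValues, K'.IsSubcomplexSpace (Subtype.val '' closure (f.rankSet m)) := by
  have hsa := MatFun.isHermitian_apply ha
  obtain ⟨η, hη, hηε, hne⟩ := exists_pos_forall_le_eigCount ha hε
  obtain ⟨δ, hδ, hδa, hδ0, hstep⟩ := exists_thresholds ha hη
  obtain ⟨K', hK', hsub⟩ := K.exists_isRefinement_subordinate n
    (fun m => isOpen_setOf_eigCount_Ici_le a.continuous hsa m (δ m))
    (fun m => isOpen_setOf_le_eigCount_Ioi a.continuous hsa (m + 1) (δ m / 2))
    (fun m => Set.eq_univ_of_forall fun x => by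
      by_contra hx
      simp only [Set.mem_union, Set.mem_ofPred_eq, not_or, not_le] at hx
      have := (hsa x).eigCount_mono (show Ici (δ m) ⊆ Ioi (δ m / 2) from fun s hs =>
        (half_lt_self (hδ m)).trans_le hs)
      omega)
  simp only [Set.mem_ofPred_eq] at hsub
  set S := a.rankValues with hS
  set A : ℕ → Set (Finset E) := fun m =>
    {s | ∀ x : K.space, (x : E) ∈ convexHull ℝ (s : Set E) → (a x).eigCount (Ici (δ m)) ≤ m}
    with hA
  have hAlow : ∀ m, ∀ s ∈ A m, ∀ t ⊆ s, t.Nonempty → t ∈ A m := fun m s hs t hts _ x hx =>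
    hs x (convexHull_mono (Finset.coe_subset.mpr hts) hx)
  set B : ℕ → Set (Finset E) := fun m => {s | ∃ j ∈ S, j < m ∧ s ∈ A j} with hB
  have hBlow : ∀ m, ∀ s ∈ B m, ∀ t ⊆ s, t.Nonempty → t ∈ B m :=
    fun m s ⟨j, hj, hjm, hs⟩ t hts ht => ⟨j, hj, hjm, hAlow j s hs t hts ht⟩
  set V : ℕ → Set K.space := fun m => Subtype.val ⁻¹' K'.polyhedron (A m) with hV
  have himage : ∀ m, (Subtype.val '' stratum S V m : Set E) =
      K'.polyhedron (A m) \ K'.polyhedron (B m) := by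
    intro m
    ext x
    constructor
    · rintro ⟨y, ⟨hy, hy'⟩, rfl⟩
      refine ⟨hy, fun hyB => ?_⟩
      obtain ⟨s, hs, ⟨j, hj, hjm, hsj⟩, hys⟩ := mem_polyhedron.mp hyB
      exact hy' j hj hjm (mem_polyhedron.mpr ⟨s, hs, hsj, hys⟩)
    · rintro ⟨hxA, hxB⟩
      obtain ⟨s, hs, hsA, hxs⟩ := mem_polyhedron.mp hxA
      refine ⟨⟨x, hK'.2.1 ▸ convexHull_subset_space hs hxs⟩, ⟨hxA, fun j hj hjm hxj => hxB ?_⟩, rfl⟩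
      obtain ⟨t, ht, htA, hxt⟩ := mem_polyhedron.mp hxj
      exact mem_polyhedron.mpr ⟨t, ht, ⟨j, hj, hjm, htA⟩, hxt⟩
  have hKc : IsClosed K.space := (isCompact_iff_compactSpace.mpr inferInstance).isClosed
  have hclosure : ∀ m, (Subtype.val '' closure (stratum S V m) : Set E) =
      K'.polyhedron (A m \ B m) := fun m => by
    rw [← hKc.isClosedEmbedding_subtypeVal.closure_image_eq, himage,
      closure_polyhedron_diff hK'.1 (hBlow m)]
  -- A simplex outside `B m` lies entirely in the second open set for each rank value j < m, so the
  -- threshold property holds on the closure and not only on the stratum.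
  have hcl : ∀ m ∈ S, ∀ x ∈ closure (stratum S V m), m ≤ (a x).eigCount (Ioi (2 * δ m)) := by
    intro m hm x hx
    have hx' : (x : E) ∈ K'.polyhedron (A m \ B m) := hclosure m ▸ Set.mem_image_of_mem _ hx
    obtain ⟨s, hs, ⟨-, hsB⟩, hxs⟩ := mem_polyhedron.mp hx'
    refine hstep m hm x fun j hj hjm => ?_
    exact ((hsub j (MatFun.le_of_mem_rankValues hj) s hs).resolve_left
      fun h => hsB ⟨j, hj, hjm, h⟩) x hxs
  obtain ⟨f, hf0, hfw, hfa, hfε, hfv, hfs⟩ := exists_isWellSupported_of_stratification ha hδ hδa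
    (by rw [hδ0]; exact hηε) (V := V)
    (fun m => (isClosed_polyhedron hK'.1 _).preimage continuous_subtype_val)
    (fun m _ x hx => by
      obtain ⟨s, -, hsA, hxs⟩ := mem_polyhedron.mp hx
      exact hsA x hxs)
    (fun m hm x hx => by
      obtain ⟨s, hs, hxs⟩ := mem_space_iff.mp (hK'.2.1.symm.subset x.2)
      exact ((hsub m (MatFun.le_of_mem_rankValues hm) s hs).resolve_left
        fun h => hx (mem_polyhedron.mpr ⟨s, hs, h, hxs⟩)) x hxs)
    hcl (by rw [hδ0]; exact hne)
  refine ⟨f, hf0, hfw, hfa, hfε, hfv, K', hK', fun m hm => ?_⟩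
  rw [hfs m (hfv ▸ hm), hclosure]
  exact isSubcomplexSpace_polyhedron K' _
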